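/- Let $\mathcal Q_0,\tilde{\mathcal Q}_1,\tilde{\mathcal Q}_2,\mathcal S,\mathcal X$ be finite alphabets, let $p(q_0,\tilde q_1,\tilde q_2)$ be a p.m.f. and $p(x\mid s,q_0,\tilde q_1)$ a conditional p.m.f. The context letters $(Q_{0,i},\tilde Q_{1,i},\tilde Q_{2,i})$, $i=1,\dots,n$, are i.i.d. with law $p(q_0,\tilde q_1,\tilde q_2)$. The sender knows $Q_1^n=(Q_0^n,\tilde Q_1^n)$ and the receiver knows $Q_2^n=(Q_0^n,\tilde Q_2^n)$, both noncausally. A code of block length $n$ and rate $R$ consists of an encoder, which maps a semantic $w\in\{1,\dots,\lceil 2^{nR}\rceil\}$ and the context $(q_0^n,\tilde q_1^n)$ to a semantic codeword $s^n\in\mathcal S^n$, and a decoder, which maps $(x^n,q_0^n,\tilde q_2^n)$ to a semantic $\hat w$; here the message codeword $X^n$ is generated from the semantic codeword and the sender's context according to $\prod_{i=1}^n p(x_i\mid s_i,q_{0,i},\tilde q_{1,i})$ and reaches the receiver without noise. The rate $R$ is achievable if there are codes of rate $R$ and of block lengths $n=0,1,2,\dots$ with $P(\hat W\ne W)\to 0$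 as $n\to\infty$, where $W$ is uniformly distributed and independent of the context. Let $U$ be an auxiliary random variable with values in a finite set $\mathcal U$, given by any conditional p.m.f. $p(u,s\mid q_0,\tilde q_1)$, and let $(Q_0,\tilde Q_1,\tilde Q_2,U,S,X)$ have the joint p.m.f. $p(q_0,\tilde q_1,\tilde q_2)\,p(u,s\mid q_0,\tilde q_1)\,p(x\mid s,q_0,\tilde q_1)$. Put $Q_2=(Q_0,\tilde Q_2)$. Then every rate $$R < I(U;X\mid Q_2)+I(U;\tilde Q_2\mid Q_0)-I(U;\tilde Q_1\mid Q_0)$$ (mutual informations in bits) is achievable. -/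

import Mathlib

open Filter Topology

namespace SemComm

noncomputable section

open Classical in
/-- The probability mass function of the random variable `A : Ω → α`, where `p` is the probability
mass function on the finite sample space `Ω`: `law p A a = P(A = a)`. -/
def law {Ω α : Type*} [Fintype Ω] (p : Ω → ℝ) (A : Ω → α) (a : α) : ℝ :=
  ∑ ω, if A ω = a then p ω else 0

/-- Conditional mutual information `I(A; B | C)` in bits,
`∑ p(a,b,c) log₂ (p(a,b,c) p(c) / (p(a,c) p(b,c)))`. A term with `p(a,b,c) = 0` is `0`; in every
other term all the probabilities in the logarithm are positive. -/
def condMutualInfo {Ω α β γ : Type*} [Fintype Ω] [Fintype α] [Fintype β] [Fintype γ]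
    (p : Ω → ℝ) (A : Ω → α) (B : Ω → β) (C : Ω → γ) : ℝ :=
  ∑ a, ∑ b, ∑ c,
    law p (fun ω => (A ω, B ω, C ω)) (a, b, c) *
      Real.logb 2
        (law p (fun ω => (A ω, B ω, C ω)) (a, b, c) * law p C c /
          (law p (fun ω => (A ω, C ω)) (a, c) * law p (fun ω => (B ω, C ω)) (b, c)))

/-- A memoryless context-dependent semantic channel over finite alphabets, whose sender and receiver
share part of the context: one letter `(Q₀, Q̃₁, Q̃₂)` of the context has the probability mass
function `ctx`, the sender's context is `Q₁ = (Q₀, Q̃₁)`, the receiver's is `Q₂ = (Q₀, Q̃₂)`, and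
`chan s q₀ q₁ x = p(x | s, q₀, q̃₁)` is the conditional probability mass function with which a
letter of the semantic codeword is expressed by a letter of the message codeword. -/
structure SemanticChannel (𝒬₀ 𝒬₁ 𝒬₂ 𝒮 𝒳 : Type*)
    [Fintype 𝒬₀] [Fintype 𝒬₁] [Fintype 𝒬₂] [Fintype 𝒳] where
  ctx : 𝒬₀ × 𝒬₁ × 𝒬₂ → ℝ
  ctx_mem : ctx ∈ stdSimplex ℝ (𝒬₀ × 𝒬₁ × 𝒬₂)
  chan : 𝒮 → 𝒬₀ → 𝒬₁ → 𝒳 → ℝ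
  chan_mem : ∀ s q₀ q₁, chan s q₀ q₁ ∈ stdSimplex ℝ 𝒳

/-- A code of block length `n` for `M` semantics. The encoder maps a semantic and the sender's
context `(q₀ⁿ, q̃₁ⁿ)` (all of it, noncausally) to a semantic codeword `sⁿ`. The decoder maps the
message codeword `xⁿ` (received without noise) and the receiver's context `(q₀ⁿ, q̃₂ⁿ)` to a
semantic. -/
structure Code (𝒬₀ 𝒬₁ 𝒬₂ 𝒮 𝒳 : Type*) (M n : ℕ) where
  enc : Fin M → (Fin n → 𝒬₀) → (Fin n → 𝒬₁) → (Fin n → 𝒮)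
  dec : (Fin n → 𝒳) → (Fin n → 𝒬₀) → (Fin n → 𝒬₂) → Fin M

variable {𝒬₀ 𝒬₁ 𝒬₂ 𝒮 𝒳 𝒰 : Type*} [Fintype 𝒬₀] [Fintype 𝒬₁] [Fintype 𝒬₂] [Fintype 𝒳]

/-- The probability of error `P(Ŵ ≠ W)` of a code, when the semantic `W` is uniformly distributed
and independent of the context, the context letters are i.i.d. with law `ctx`, and the message
codeword is generated letter by letter by `chan`. -/
def SemanticChannel.errorProb (ch : SemanticChannel 𝒬₀ 𝒬₁ 𝒬₂ 𝒮 𝒳) {M n : ℕ}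
    (c : Code 𝒬₀ 𝒬₁ 𝒬₂ 𝒮 𝒳 M n) : ℝ :=
  (1 / (M : ℝ)) * ∑ w : Fin M,
    ∑ q₀ : Fin n → 𝒬₀, ∑ q₁ : Fin n → 𝒬₁, ∑ q₂ : Fin n → 𝒬₂, ∑ x : Fin n → 𝒳,
      (∏ i, ch.ctx (q₀ i, q₁ i, q₂ i)) *
        (∏ i, ch.chan (c.enc w q₀ q₁ i) (q₀ i) (q₁ i) (x i)) *
          (if c.dec x q₀ q₂ = w then 0 else 1)

/-- The rate `R` (in bits per letter) is achievable: there are codes for `⌈2 ^ (n R)⌉` semantics of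
block length `n = 0, 1, 2, …` whose probability of error tends to zero. -/
def SemanticChannel.Achievable (ch : SemanticChannel 𝒬₀ 𝒬₁ 𝒬₂ 𝒮 𝒳) (R : ℝ) : Prop :=
  ∃ c : ∀ n : ℕ, Code 𝒬₀ 𝒬₁ 𝒬₂ 𝒮 𝒳 ⌈(2 : ℝ) ^ ((n : ℝ) * R)⌉₊ n,
    Tendsto (fun n => ch.errorProb (c n)) atTop (𝓝 0)

/-- One letter `(q₀, q̃₁, q̃₂, u, s, x)` of all the variables. -/
abbrev Letter (𝒬₀ 𝒬₁ 𝒬₂ 𝒰 𝒮 𝒳 : Type*) := 𝒬₀ × 𝒬₁ × 𝒬₂ × 𝒰 × 𝒮 × 𝒳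

/-- The joint probability mass function
`p(q₀, q̃₁, q̃₂) p(u, s | q₀, q̃₁) p(x | s, q₀, q̃₁)` of `(Q₀, Q̃₁, Q̃₂, U, S, X)`, where
`V q₀ q₁ (u, s) = p(u, s | q₀, q̃₁)`. -/
def SemanticChannel.joint (ch : SemanticChannel 𝒬₀ 𝒬₁ 𝒬₂ 𝒮 𝒳) (V : 𝒬₀ → 𝒬₁ → 𝒰 × 𝒮 → ℝ) :
    Letter 𝒬₀ 𝒬₁ 𝒬₂ 𝒰 𝒮 𝒳 → ℝ :=
  fun (q₀, q₁, q₂, u, s, x) => ch.ctx (q₀, q₁, q₂) * V q₀ q₁ (u, s) * ch.chan s q₀ q₁ x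

/-- The shared context `Q₀`. -/
def ctxShared (ω : Letter 𝒬₀ 𝒬₁ 𝒬₂ 𝒰 𝒮 𝒳) : 𝒬₀ := ω.1

/-- The private context `Q̃₁` of the sender. -/
def ctxSender (ω : Letter 𝒬₀ 𝒬₁ 𝒬₂ 𝒰 𝒮 𝒳) : 𝒬₁ := ω.2.1

/-- The private context `Q̃₂` of the receiver. -/
def ctxReceiver (ω : Letter 𝒬₀ 𝒬₁ 𝒬₂ 𝒰 𝒮 𝒳) : 𝒬₂ := ω.2.2.1

/-- The receiver's whole context `Q₂ = (Q₀, Q̃₂)`. -/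
def ctxReceiverAll (ω : Letter 𝒬₀ 𝒬₁ 𝒬₂ 𝒰 𝒮 𝒳) : 𝒬₀ × 𝒬₂ := (ctxShared ω, ctxReceiver ω)

/-- The auxiliary variable `U`. -/
def auxVar (ω : Letter 𝒬₀ 𝒬₁ 𝒬₂ 𝒰 𝒮 𝒳) : 𝒰 := ω.2.2.2.1

/-- The letter `X` of the message codeword. -/
def message (ω : Letter 𝒬₀ 𝒬₁ 𝒬₂ 𝒰 𝒮 𝒳) : 𝒳 := ω.2.2.2.2.2

end

end SemComm

namespace SemComm

/-! ### One-shot coding with side information -/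

/-! By the chain rule the bound on $R$ equals $I(U;\tilde Q_2,X\mid Q_0)-I(U;\tilde Q_1\mid Q_0)$.
This is Gelfand–Pinsker coding with output $(\tilde Q_2,X)$ and state $\tilde Q_1$, conducted
separately for each shared block $q_0^n$.

The argument is one-shot and avoids typical sequences. Draw $ML$ independent codewords from
$P=\prod_i p(u_i\mid q_{0,i})$, with $L$ of them in the bin of each semantic. The encoder picks a
codeword of its bin with probability proportional to the likelihood ratio $f=p(u\mid q_0,\tilde
q_1)/p(u\mid q_0)$, then draws $s$ from $p(s\mid u,q_0,\tilde q_1)$; the decoder picks among all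
codewords in proportion to $g=p(u\mid q_0,\tilde q_2,x)/p(u\mid q_0)$. Given the codeword in use,
every other codeword has mean score at most 1, so Jensen's inequality (`le_sum_codebook_div`) bounds
the mean probability of success below by the mean of $\frac{L}{f+L}\cdot\frac{g}{g+ML}$. Success is
linear in the codebook law, the decoder and the encoder, hence deterministic choices do as well
(`exists_code_oneShot`).

The error is therefore at most the mean of $\frac{f}{f+L}+\frac{ML}{ML+g}$. Each fraction is at most
a $t$-th power of a product over letters, $0<t\le1$, so its mean is bounded by an $n$-th power, up
to a constant. With $L\approx2^{nr}$, $I(U;\tilde Q_1\mid Q_0)<r$ and $R+r<I(U;\tilde Q_2,X\mid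
Q_0)$, the logarithms have negative mean, and a small $t$ makes both bases less than 1
(`exists_sum_mul_rpow_lt_one`). -/

theorem sum_pi_prod {ι α : Type*} [Fintype ι] [Fintype α] [DecidableEq ι] (F : ι → α → ℝ) :
    ∑ c : ι → α, ∏ i, F i (c i) = ∏ i, ∑ a, F i a := by
  rw [Finset.prod_univ_sum, Fintype.piFinset_univ]

/-- A weighted sum with weights of total mass at most one is at most one of its terms. -/
theorem exists_sum_mul_le {ι : Type*} [Fintype ι] [Nonempty ι] (c h : ι → ℝ)
    (hc : ∀ i, 0 ≤ c i) (hc1 : ∑ i, c i ≤ 1) (hh : ∀ i, 0 ≤ h i) :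
    ∃ i, ∑ j, c j * h j ≤ h i := by
  obtain ⟨i, hi⟩ := Finite.exists_max h
  refine ⟨i, ?_⟩
  calc ∑ j, c j * h j ≤ ∑ j, c j * h i :=
        Finset.sum_le_sum fun j _ => mul_le_mul_of_nonneg_left (hi j) (hc j)
    _ = (∑ j, c j) * h i := by rw [Finset.sum_mul]
    _ ≤ h i := mul_le_of_le_one_left (hh i) hc1

theorem sum_div_sum_le_one {ι : Type*} [Fintype ι] (f : ι → ℝ) :
    ∑ i, f i / ∑ j, f j ≤ 1 := by
  rw [← Finset.sum_div]
  exact div_self_le_one _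

/-- The convex function $1/(xy)$ lies above its tangent plane at $(1,1)$. By AM-GM it suffices to
take $x=y=z$, where the claim is $(z-1)^2(2z+1)\ge0$. -/
theorem three_sub_sub_le_inv {x y : ℝ} (hx : 0 < x) (hy : 0 < y) : 3 - x - y ≤ (x * y)⁻¹ := by
  have h1 : x * y ≤ ((x + y) / 2) ^ 2 := by nlinarith [sq_nonneg (x - y)]
  have h2 : (((x + y) / 2) ^ 2)⁻¹ ≤ (x * y)⁻¹ := inv_anti₀ (by positivity) h1
  refine le_trans ?_ h2
  have hz : 0 < (x + y) / 2 := by positivity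
  have : 3 - x - y = 3 - 2 * ((x + y) / 2) := by ring
  rw [this]
  generalize (x + y) / 2 = z at hz
  rw [← one_div, le_div_iff₀ (by positivity)]
  nlinarith [mul_nonneg (sq_nonneg (z - 1)) (by linarith : 0 ≤ 2 * z + 1)]

/-! ### Averages over a codebook of independent codewords -/

section Codebook

variable {κ U : Type*} [Fintype κ] [DecidableEq κ] [Fintype U]

theorem sum_codebook_single (P : U → ℝ) (hP1 : ∑ u, P u = 1) (k : κ) (F : U → ℝ) :
    ∑ C : κ → U, (∏ j, P (C j)) * F (C k) = ∑ u, P u * F u := by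
  have h : ∀ C : κ → U, (∏ j, P (C j)) * F (C k) =
      ∏ j, P (C j) * (if j = k then F (C j) else 1) := by
    intro C
    rw [Finset.prod_mul_distrib, Finset.prod_ite_eq' Finset.univ k fun j => F (C j)]
    simp
  simp_rw [h]
  rw [sum_pi_prod fun j u => P u * (if j = k then F u else 1)]
  rw [Finset.prod_eq_single k]
  · simp
  · intro j _ hj; simp [hj, hP1]
  · simp

theorem sum_codebook_pair (P : U → ℝ) (hP1 : ∑ u, P u = 1) {k l : κ} (hkl : k ≠ l)
    (F G : U → ℝ) :
    ∑ C : κ → U, (∏ j, P (C j)) * (F (C k) * G (C l)) = (∑ u, P u * F u) * ∑ u, P u * G u := by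
  have h : ∀ C : κ → U, (∏ j, P (C j)) * (F (C k) * G (C l)) =
      ∏ j, P (C j) * ((if j = k then F (C j) else 1) * (if j = l then G (C j) else 1)) := by
    intro C
    rw [Finset.prod_mul_distrib, Finset.prod_mul_distrib,
      Finset.prod_ite_eq' Finset.univ k fun j => F (C j),
      Finset.prod_ite_eq' Finset.univ l fun j => G (C j)]
    simp
  simp_rw [h]
  rw [sum_pi_prod fun j u => P u * ((if j = k then F u else 1) * (if j = l then G u else 1))]
  rw [Finset.prod_eq_mul k l hkl]
  · simp [hkl, hkl.symm]
  · intro j _ hj; simp [hj.1, hj.2, hP1]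
  · simp
  · simp

/-- The mean of the total score `∑ φ (C j)` over the codewords `j ∈ T`, given the codeword `k`. -/
theorem sum_codebook_mul_sum_le (P : U → ℝ) (hP : ∀ u, 0 ≤ P u) (hP1 : ∑ u, P u = 1) (k : κ)
    (T : Finset κ) (hk : k ∈ T) (H φ : U → ℝ) (hH : ∀ u, 0 ≤ H u)
    (hφ1 : ∑ u, P u * φ u ≤ 1) :
    ∑ C : κ → U, (∏ j, P (C j)) * (H (C k) * ∑ j ∈ T, φ (C j)) ≤
      ∑ u, P u * (H u * (φ u + T.card)) := by
  have hswap : ∑ C : κ → U, (∏ j, P (C j)) * (H (C k) * ∑ j ∈ T, φ (C j)) =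
      ∑ l ∈ T, ∑ C : κ → U, (∏ j, P (C j)) * (H (C k) * φ (C l)) := by
    rw [Finset.sum_comm]
    simp_rw [Finset.mul_sum]
  have hEH : 0 ≤ ∑ u, P u * H u := Finset.sum_nonneg fun u _ => mul_nonneg (hP u) (hH u)
  rw [hswap, ← Finset.add_sum_erase T _ hk,
    sum_codebook_single P hP1 k fun u => H u * φ u]
  have hrest : ∑ l ∈ T.erase k, ∑ C : κ → U, (∏ j, P (C j)) * (H (C k) * φ (C l)) ≤
      ∑ l ∈ T.erase k, ∑ u, P u * H u := by
    -- A codeword other than `k` is independent of it and has mean score at most 1.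
    refine Finset.sum_le_sum fun l hl => ?_
    rw [sum_codebook_pair P hP1 (Finset.ne_of_mem_erase hl).symm]
    exact mul_le_of_le_one_right hEH hφ1
  have hcard : ∑ l ∈ T.erase k, ∑ u, P u * H u ≤ T.card * ∑ u, P u * H u := by
    rw [Finset.sum_const, nsmul_eq_mul]
    refine mul_le_mul_of_nonneg_right ?_ hEH
    exact_mod_cast Finset.card_erase_le
  have hsplit : ∑ u, P u * (H u * (φ u + T.card)) =
      ∑ u, P u * (H u * φ u) + T.card * ∑ u, P u * H u := by
    rw [Finset.mul_sum, ← Finset.sum_add_distrib]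
    exact Finset.sum_congr rfl fun u _ => by ring
  rw [hsplit]
  linarith

/-- Jensen's inequality for the likelihood encoder and decoder, given the codeword `k`. -/
theorem le_sum_codebook_div (P : U → ℝ) (hP : ∀ u, 0 ≤ P u) (hP1 : ∑ u, P u = 1) (k : κ)
    (T : Finset κ) (hk : k ∈ T) (f g v : U → ℝ) (hf : ∀ u, 0 ≤ f u) (hg : ∀ u, 0 ≤ g u)
    (hv : ∀ u, 0 ≤ v u) (hf1 : ∑ u, P u * f u ≤ 1) (hg1 : ∑ u, P u * g u ≤ 1) :
    ∑ u, P u * (f u / (f u + T.card) * v u * (g u / (g u + Fintype.card κ))) ≤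
      ∑ C : κ → U, (∏ j, P (C j)) *
        (f (C k) / (∑ j ∈ T, f (C j)) * v (C k) * (g (C k) / ∑ j, g (C j))) := by
  have hT : (0 : ℝ) < T.card := by exact_mod_cast Finset.card_pos.2 ⟨k, hk⟩
  have hκ : (0 : ℝ) < Fintype.card κ := by exact_mod_cast Fintype.card_pos_iff.2 ⟨k⟩
  set α : U → ℝ := fun u => f u + T.card with hα
  set β : U → ℝ := fun u => g u + Fintype.card κ with hβ
  have hα0 : ∀ u, 0 < α u := fun u => by have := hf u; simp only [hα]; linarith
  have hβ0 : ∀ u, 0 < β u := fun u => by have := hg u; simp only [hβ]; linarith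
  set h : U → ℝ := fun u => f u / α u * v u * (g u / β u) with hh
  have hh0 : ∀ u, 0 ≤ h u := fun u => by
    have := hf u; have := hg u; have := hv u; have := hα0 u; have := hβ0 u
    simp only [hh]; positivity
  -- The tangent plane inequality at the two score sums divided by `α` and `β`, which bound their
  -- conditional means. This replaces Jensen's inequality by a bound linear in each sum.
  have hpt : ∀ C : κ → U,
      3 * h (C k) - h (C k) / α (C k) * (∑ j ∈ T, f (C j)) - h (C k) / β (C k) * ∑ j, g (C j) ≤
        f (C k) / (∑ j ∈ T, f (C j)) * v (C k) * (g (C k) / ∑ j, g (C j)) := by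
    intro C
    have hA : f (C k) ≤ ∑ j ∈ T, f (C j) :=
      Finset.single_le_sum (f := fun j => f (C j)) (fun j _ => hf _) hk
    have hB : g (C k) ≤ ∑ j, g (C j) :=
      Finset.single_le_sum (f := fun j => g (C j)) (fun j _ => hg _) (Finset.mem_univ k)
    rcases (hf (C k)).eq_or_lt with hf0 | hf0
    · simp [hh, ← hf0]
    rcases (hg (C k)).eq_or_lt with hg0 | hg0
    · simp [hh, ← hg0]
    have hA0 := hf0.trans_le hA
    have hB0 := hg0.trans_le hB
    have ha := hα0 (C k)
    have hb := hβ0 (C k)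
    have key := mul_le_mul_of_nonneg_left
      (three_sub_sub_le_inv (div_pos hA0 ha) (div_pos hB0 hb)) (hh0 (C k))
    refine (le_of_eq ?_).trans (key.trans (le_of_eq ?_))
    · field_simp
    · simp only [hh]; field_simp
  have hsum : ∑ C : κ → U, (∏ j, P (C j)) *
      (3 * h (C k) - h (C k) / α (C k) * (∑ j ∈ T, f (C j)) - h (C k) / β (C k) * ∑ j, g (C j)) =
      3 * (∑ C : κ → U, (∏ j, P (C j)) * h (C k))
      - ∑ C : κ → U, (∏ j, P (C j)) * (h (C k) / α (C k) * ∑ j ∈ T, f (C j))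
      - ∑ C : κ → U, (∏ j, P (C j)) * (h (C k) / β (C k) * ∑ j, g (C j)) := by
    rw [Finset.mul_sum, ← Finset.sum_sub_distrib, ← Finset.sum_sub_distrib]
    exact Finset.sum_congr rfl fun C _ => by ring
  -- Each linear correction has mean at most that of `h`, so one of the three copies of `h`
  -- survives.
  have h1 := sum_codebook_mul_sum_le P hP hP1 k T hk (fun u => h u / α u) f
    (fun u => div_nonneg (hh0 u) (hα0 u).le) hf1
  have h2 := sum_codebook_mul_sum_le P hP hP1 k Finset.univ (Finset.mem_univ k)
    (fun u => h u / β u) g (fun u => div_nonneg (hh0 u) (hβ0 u).le) hg1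
  have e1 : ∑ u, P u * (h u / α u * (f u + T.card)) = ∑ u, P u * h u :=
    Finset.sum_congr rfl fun u _ => by rw [div_mul_cancel₀ _ (hα0 u).ne']
  have e2 : ∑ u, P u * (h u / β u * (g u + (Finset.univ : Finset κ).card)) = ∑ u, P u * h u :=
    Finset.sum_congr rfl fun u _ => by rw [Finset.card_univ, div_mul_cancel₀ _ (hβ0 u).ne']
  rw [e1] at h1
  rw [e2] at h2
  calc ∑ u, P u * h u ≤ _ := by
        rw [sum_codebook_single P hP1 k h] at hsum
        linarith
    _ ≤ _ := Finset.sum_le_sum fun C _ =>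
        mul_le_mul_of_nonneg_left (hpt C) (Finset.prod_nonneg fun j _ => hP _)

end Codebook

/-- A randomized encoder and a randomized decoder can be replaced by deterministic ones. -/
theorem exists_deterministic_code {A S Y : Type*} [Fintype A] [Fintype S] [Fintype Y] [Nonempty S]
    {M : ℕ} [NeZero M] (W : A → S → Y → ℝ) (hW : ∀ a s y, 0 ≤ W a s y)
    (e : Fin M → A → S → ℝ) (he : ∀ w a s, 0 ≤ e w a s) (he1 : ∀ w a, ∑ s, e w a s ≤ 1)
    (d : Y → Fin M → ℝ) (hd : ∀ y w, 0 ≤ d y w) (hd1 : ∀ y, ∑ w, d y w ≤ 1) :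
    ∃ (enc : Fin M → A → S) (dec : Y → Fin M),
      ∑ w, ∑ a, ∑ s, ∑ y, e w a s * (W a s y * d y w) ≤
        ∑ w, ∑ a, ∑ y, W a (enc w a) y * (if dec y = w then 1 else 0) := by
  -- Success is linear in each row `d y` and, once the decoder is fixed, in each row `e w a`; a best
  -- entry replaces the row.
  have hdec : ∀ y, ∃ w', ∑ w, d y w * (∑ a, ∑ s, e w a s * W a s y) ≤
      ∑ a, ∑ s, e w' a s * W a s y := fun y =>
    exists_sum_mul_le (d y) (fun w => ∑ a, ∑ s, e w a s * W a s y) (hd y) (hd1 y) fun w =>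
      Finset.sum_nonneg fun a _ => Finset.sum_nonneg fun s _ => mul_nonneg (he _ _ _) (hW _ _ _)
  choose dec hdec using hdec
  have henc : ∀ w a, ∃ s', ∑ s, e w a s * (∑ y, W a s y * (if dec y = w then 1 else 0)) ≤
      ∑ y, W a s' y * (if dec y = w then 1 else 0) := fun w a =>
    exists_sum_mul_le (e w a) (fun s => ∑ y, W a s y * (if dec y = w then 1 else 0)) (he w a)
      (he1 w a) fun s => Finset.sum_nonneg fun y _ => mul_nonneg (hW _ _ _) (by split_ifs <;> simp)
  choose enc henc using henc
  refine ⟨enc, dec, ?_⟩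
  calc ∑ w, ∑ a, ∑ s, ∑ y, e w a s * (W a s y * d y w)
      = ∑ y, ∑ w, d y w * (∑ a, ∑ s, e w a s * W a s y) := by
        rw [Finset.sum_comm (s := (Finset.univ : Finset Y))]
        refine Finset.sum_congr rfl fun w _ => ?_
        simp_rw [Finset.mul_sum]
        rw [Finset.sum_comm (s := (Finset.univ : Finset Y))]
        refine Finset.sum_congr rfl fun a _ => ?_
        rw [Finset.sum_comm]
        exact Finset.sum_congr rfl fun y _ => Finset.sum_congr rfl fun s _ => by ring
    _ ≤ ∑ y, ∑ a, ∑ s, e (dec y) a s * W a s y := Finset.sum_le_sum fun y _ => hdec y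
    _ = ∑ y, ∑ w, (if dec y = w then 1 else 0) * (∑ a, ∑ s, e w a s * W a s y) := by simp
    _ = ∑ w, ∑ a, ∑ s, e w a s * (∑ y, W a s y * (if dec y = w then 1 else 0)) := by
        rw [Finset.sum_comm (s := (Finset.univ : Finset Y))]
        refine Finset.sum_congr rfl fun w _ => ?_
        simp_rw [Finset.mul_sum]
        rw [Finset.sum_comm (s := (Finset.univ : Finset Y))]
        refine Finset.sum_congr rfl fun a _ => ?_
        rw [Finset.sum_comm]
        exact Finset.sum_congr rfl fun y _ => Finset.sum_congr rfl fun s _ => by ring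
    _ ≤ _ := Finset.sum_le_sum fun w _ => Finset.sum_le_sum fun a _ => henc w a

/-- The one-shot achievability bound for coding with side information at the encoder. -/
theorem exists_code_oneShot {A S Y U : Type*} [Fintype A] [Fintype S] [Fintype Y] [Fintype U]
    [Nonempty S] {M L : ℕ} [NeZero M] (W : A → S → Y → ℝ) (hW : ∀ a s y, 0 ≤ W a s y)
    (P : U → ℝ) (hP : ∀ u, 0 ≤ P u) (hP1 : ∑ u, P u = 1)
    (f : A → U → ℝ) (hf : ∀ a u, 0 ≤ f a u) (hf1 : ∀ a, ∑ u, P u * f a u ≤ 1)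
    (g : Y → U → ℝ) (hg : ∀ y u, 0 ≤ g y u) (hg1 : ∀ y, ∑ u, P u * g y u ≤ 1)
    (v : A → U → S → ℝ) (hv : ∀ a u s, 0 ≤ v a u s) (hv1 : ∀ a u, ∑ s, v a u s ≤ 1) :
    ∃ (enc : Fin M → A → S) (dec : Y → Fin M),
      M * ∑ a, ∑ u, ∑ s, ∑ y, P u * f a u * v a u s * W a s y *
          (L / (f a u + L) * (g y u / (g y u + M * L))) ≤
        ∑ w, ∑ a, ∑ y, W a (enc w a) y * (if dec y = w then 1 else 0) := by
  classical
  have hU : Nonempty U := by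
    by_contra h
    rw [not_nonempty_iff] at h
    simp at hP1
  -- Likelihood encoder and decoder. When all scores vanish, division by zero gives a zero row, so
  -- rows have mass at most 1 rather than exactly 1.
  set e : (Fin M × Fin L → U) → Fin M → A → S → ℝ := fun C w a s =>
    ∑ l, f a (C (w, l)) / (∑ l', f a (C (w, l'))) * v a (C (w, l)) s with he
  set d : (Fin M × Fin L → U) → Y → Fin M → ℝ := fun C y w =>
    ∑ l, g y (C (w, l)) / ∑ k, g y (C k) with hd
  have he0 : ∀ C w a s, 0 ≤ e C w a s := fun C w a s => Finset.sum_nonneg fun l _ =>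
    mul_nonneg (div_nonneg (hf _ _) (Finset.sum_nonneg fun _ _ => hf _ _)) (hv _ _ _)
  have hd0 : ∀ C y w, 0 ≤ d C y w := fun C y w => Finset.sum_nonneg fun l _ =>
    div_nonneg (hg _ _) (Finset.sum_nonneg fun _ _ => hg _ _)
  have he1 : ∀ C w a, ∑ s, e C w a s ≤ 1 := by
    intro C w a
    simp only [he]
    rw [Finset.sum_comm]
    refine le_trans (Finset.sum_le_sum fun l _ => ?_)
      (sum_div_sum_le_one fun l => f a (C (w, l)))
    rw [← Finset.mul_sum]
    exact mul_le_of_le_one_right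
      (div_nonneg (hf _ _) (Finset.sum_nonneg fun _ _ => hf _ _)) (hv1 _ _)
  have hd1 : ∀ C y, ∑ w, d C y w ≤ 1 := by
    intro C y
    simp only [hd]
    rw [← Fintype.sum_prod_type' (f := fun w l => g y (C (w, l)) / ∑ k, g y (C k))]
    exact sum_div_sum_le_one fun k => g y (C k)
  have hW' : ∀ C : Fin M × Fin L → U,
      0 ≤ ∑ w, ∑ a, ∑ s, ∑ y, e C w a s * (W a s y * d C y w) := fun C =>
    Finset.sum_nonneg fun w _ => Finset.sum_nonneg fun a _ => Finset.sum_nonneg fun s _ =>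
      Finset.sum_nonneg fun y _ => mul_nonneg (he0 _ _ _ _) (mul_nonneg (hW _ _ _) (hd0 _ _ _))
  have hPC : ∀ C : Fin M × Fin L → U, 0 ≤ ∏ j, P (C j) := fun C =>
    Finset.prod_nonneg fun j _ => hP _
  obtain ⟨C, hC⟩ := exists_sum_mul_le (fun C : Fin M × Fin L → U => ∏ j, P (C j))
    (fun C => ∑ w, ∑ a, ∑ s, ∑ y, e C w a s * (W a s y * d C y w)) hPC
    (by rw [sum_pi_prod fun _ u => P u]; simp [hP1]) hW'
  obtain ⟨enc, dec, hcode⟩ := exists_deterministic_code W hW (e C) (he0 C) (he1 C)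
    (d C) (hd0 C) (hd1 C)
  refine ⟨enc, dec, le_trans ?_ (hC.trans hcode)⟩
  have hterm : ∀ w a s y,
      ∑ u, P u * f a u * v a u s * W a s y * (L / (f a u + L) * (g y u / (g y u + M * L))) ≤
      ∑ C : Fin M × Fin L → U, (∏ j, P (C j)) * (e C w a s * (W a s y * d C y w)) := by
    intro w a s y
    -- Only the event that the decoder finds the very codeword sent is kept; the rest of its bin is
    -- discarded.
    have hdiag : ∀ C : Fin M × Fin L → U,
        ∑ l, W a s y * (f a (C (w, l)) / (∑ l', f a (C (w, l'))) * v a (C (w, l)) s *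
          (g y (C (w, l)) / ∑ k, g y (C k))) ≤ e C w a s * (W a s y * d C y w) := by
      intro C
      have : e C w a s * (W a s y * d C y w) = ∑ l, W a s y *
          (f a (C (w, l)) / (∑ l', f a (C (w, l'))) * v a (C (w, l)) s * d C y w) := by
        simp only [he]
        rw [Finset.sum_mul]
        exact Finset.sum_congr rfl fun l _ => by ring
      rw [this]
      refine Finset.sum_le_sum fun l _ => mul_le_mul_of_nonneg_left
        (mul_le_mul_of_nonneg_left ?_ (mul_nonneg
          (div_nonneg (hf _ _) (Finset.sum_nonneg fun _ _ => hf _ _)) (hv _ _ _))) (hW _ _ _)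
      simp only [hd]
      exact Finset.single_le_sum (f := fun l => g y (C (w, l)) / ∑ k, g y (C k))
        (fun l _ => div_nonneg (hg _ _) (Finset.sum_nonneg fun _ _ => hg _ _)) (Finset.mem_univ l)
    have hl : ∀ l : Fin L,
        W a s y * ∑ u, P u * (f a u / (f a u + L) * v a u s * (g y u / (g y u + M * L))) ≤
        ∑ C : Fin M × Fin L → U, (∏ j, P (C j)) * (W a s y *
          (f a (C (w, l)) / (∑ l', f a (C (w, l'))) * v a (C (w, l)) s *
            (g y (C (w, l)) / ∑ k, g y (C k)))) := by
      intro l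
      have hJ := le_sum_codebook_div P hP hP1 (w, l)
        (Finset.univ.map ⟨fun l : Fin L => (w, l), Prod.mk_right_injective w⟩) (by simp)
        (f a) (g y) (fun u => v a u s) (hf a) (hg y) (fun u => hv a u s) (hf1 a) (hg1 y)
      simp only [Finset.card_map, Finset.card_univ, Fintype.card_fin, Fintype.card_prod,
        Nat.cast_mul, Finset.sum_map, Function.Embedding.coeFn_mk] at hJ
      refine (mul_le_mul_of_nonneg_left hJ (hW a s y)).trans (le_of_eq ?_)
      rw [Finset.mul_sum]
      exact Finset.sum_congr rfl fun C _ => by ring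
    -- The bound is the same for all `L` codewords of the bin, whence the numerator `L`.
    calc _ = ∑ l : Fin L, W a s y *
          ∑ u, P u * (f a u / (f a u + L) * v a u s * (g y u / (g y u + M * L))) := by
          rw [Finset.sum_const, Finset.card_univ, Fintype.card_fin, nsmul_eq_mul,
            Finset.mul_sum, Finset.mul_sum]
          exact Finset.sum_congr rfl fun u _ => by ring
      _ ≤ _ := Finset.sum_le_sum fun l _ => hl l
      _ = ∑ C : Fin M × Fin L → U, (∏ j, P (C j)) * ∑ l, (W a s y *
          (f a (C (w, l)) / (∑ l', f a (C (w, l'))) * v a (C (w, l)) s *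
            (g y (C (w, l)) / ∑ k, g y (C k)))) := by
          rw [Finset.sum_comm]
          simp_rw [Finset.mul_sum]
      _ ≤ _ := Finset.sum_le_sum fun C _ => mul_le_mul_of_nonneg_left (hdiag C) (hPC C)
  have hsum : ∑ C : Fin M × Fin L → U, (∏ j, P (C j)) *
      (∑ w, ∑ a, ∑ s, ∑ y, e C w a s * (W a s y * d C y w)) =
      ∑ w, ∑ a, ∑ s, ∑ y, ∑ C : Fin M × Fin L → U,
        (∏ j, P (C j)) * (e C w a s * (W a s y * d C y w)) := by
    simp_rw [Finset.mul_sum]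
    rw [Finset.sum_comm]
    refine Finset.sum_congr rfl fun w _ => ?_
    rw [Finset.sum_comm]
    refine Finset.sum_congr rfl fun a _ => ?_
    rw [Finset.sum_comm]
    refine Finset.sum_congr rfl fun s _ => ?_
    rw [Finset.sum_comm]
  rw [hsum]
  calc _ = ∑ _w : Fin M, ∑ a, ∑ s, ∑ y, ∑ u, P u * f a u * v a u s * W a s y *
        (L / (f a u + L) * (g y u / (g y u + M * L))) := by
        rw [Finset.sum_const, Finset.card_univ, Fintype.card_fin, nsmul_eq_mul]
        congr 1
        refine Finset.sum_congr rfl fun a _ => ?_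
        rw [Finset.sum_comm]
        refine Finset.sum_congr rfl fun s _ => ?_
        rw [Finset.sum_comm]
    _ ≤ _ := Finset.sum_le_sum fun w _ => Finset.sum_le_sum fun a _ =>
        Finset.sum_le_sum fun s _ => Finset.sum_le_sum fun y _ => hterm w a s y

/-! ### Information densities -/

section Info

variable {Ω α β γ δ : Type*} [Fintype Ω]

theorem law_nonneg {p : Ω → ℝ} (hp : ∀ ω, 0 ≤ p ω) (A : Ω → α) (a : α) : 0 ≤ law p A a :=
  Finset.sum_nonneg fun ω _ => by split_ifs <;> simp [hp]

theorem law_congr (p : Ω → ℝ) {A : Ω → α} {B : Ω → β} {a : α} {b : β}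
    (h : ∀ ω, A ω = a ↔ B ω = b) : law p A a = law p B b := by
  unfold law
  refine Finset.sum_congr rfl fun ω _ => ?_
  by_cases h' : B ω = b <;> simp [h, h']

theorem law_eq_sum_ite (p : Ω → ℝ) {A : Ω → α} {a : α} (E : Ω → Prop) [DecidablePred E]
    (h : ∀ ω, A ω = a ↔ E ω) : law p A a = ∑ ω, if E ω then p ω else 0 := by
  unfold law
  refine Finset.sum_congr rfl fun ω _ => ?_
  by_cases h' : E ω <;> simp [h, h']

open Classical in
theorem law_pos {p : Ω → ℝ} (hp : ∀ ω, 0 ≤ p ω) (A : Ω → α) {ω : Ω} (hω : 0 < p ω) :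
    0 < law p A (A ω) := by
  refine lt_of_lt_of_le ?_ (Finset.single_le_sum
    (f := fun ω' => if A ω' = A ω then p ω' else 0)
    (fun ω' _ => by split_ifs <;> simp [hp]) (Finset.mem_univ ω))
  simpa using hω

theorem sum_law_mul [Fintype α] (p : Ω → ℝ) (A : Ω → α) (F : α → ℝ) :
    ∑ a, law p A a * F a = ∑ ω, p ω * F (A ω) := by
  simp_rw [law, Finset.sum_mul]
  rw [Finset.sum_comm]
  refine Finset.sum_congr rfl fun ω _ => ?_
  rw [Finset.sum_eq_single (A ω) (fun a _ ha => by simp [ha.symm]) (by simp)]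
  simp

theorem sum_law [Fintype α] (p : Ω → ℝ) (A : Ω → α) : ∑ a, law p A a = ∑ ω, p ω := by
  simpa using sum_law_mul p A fun _ => 1

theorem sum_law_fst [Fintype α] (p : Ω → ℝ) (A : Ω → α) (B : Ω → β) (b : β) :
    ∑ a, law p (fun ω => (A ω, B ω)) (a, b) = law p B b := by
  simp_rw [law]
  rw [Finset.sum_comm]
  refine Finset.sum_congr rfl fun ω _ => ?_
  rw [Finset.sum_eq_single (A ω) (fun a _ ha => by simp [ha.symm]) (by simp)]
  by_cases h : B ω = b <;> simp [h]

theorem sum_law_mid [Fintype β] (p : Ω → ℝ) (A : Ω → α) (B : Ω → β) (C : Ω → γ) (a : α) (c : γ) :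
    ∑ b, law p (fun ω => (A ω, B ω, C ω)) (a, b, c) = law p (fun ω => (A ω, C ω)) (a, c) := by
  simp_rw [law]
  rw [Finset.sum_comm]
  refine Finset.sum_congr rfl fun ω _ => ?_
  rw [Finset.sum_eq_single (B ω) (fun b _ hb => by simp [hb.symm]) (by simp)]
  by_cases h : C ω = c <;> by_cases h' : A ω = a <;> simp [h, h']

/-- The ratio whose logarithm is the conditional information density of `A` and `B` given `C`. -/
noncomputable def infoRatio (p : Ω → ℝ) (A : Ω → α) (B : Ω → β) (C : Ω → γ) (a : α) (b : β)
    (c : γ) : ℝ :=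
  law p (fun ω => (A ω, B ω, C ω)) (a, b, c) * law p C c /
    (law p (fun ω => (A ω, C ω)) (a, c) * law p (fun ω => (B ω, C ω)) (b, c))

theorem infoRatio_nonneg {p : Ω → ℝ} (hp : ∀ ω, 0 ≤ p ω) (A : Ω → α) (B : Ω → β) (C : Ω → γ)
    (a : α) (b : β) (c : γ) : 0 ≤ infoRatio p A B C a b c :=
  div_nonneg (mul_nonneg (law_nonneg hp _ _) (law_nonneg hp _ _))
    (mul_nonneg (law_nonneg hp _ _) (law_nonneg hp _ _))

theorem infoRatio_pos {p : Ω → ℝ} (hp : ∀ ω, 0 ≤ p ω) (A : Ω → α) (B : Ω → β) (C : Ω → γ)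
    {ω : Ω} (hω : 0 < p ω) : 0 < infoRatio p A B C (A ω) (B ω) (C ω) :=
  div_pos (mul_pos (law_pos hp (fun ω => (A ω, B ω, C ω)) hω) (law_pos hp C hω))
    (mul_pos (law_pos hp (fun ω => (A ω, C ω)) hω) (law_pos hp (fun ω => (B ω, C ω)) hω))

theorem condMutualInfo_eq_sum [Fintype α] [Fintype β] [Fintype γ] (p : Ω → ℝ) (A : Ω → α)
    (B : Ω → β) (C : Ω → γ) :
    condMutualInfo p A B C = ∑ ω, p ω * Real.logb 2 (infoRatio p A B C (A ω) (B ω) (C ω)) := by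
  rw [← sum_law_mul p (fun ω => (A ω, B ω, C ω))
    fun abc => Real.logb 2 (infoRatio p A B C abc.1 abc.2.1 abc.2.2)]
  simp_rw [Fintype.sum_prod_type]
  rfl

/-- Holds pointwise for the densities: in the product of the two ratios $p(c,d)$ and $p(a,c,d)$
cancel. -/
theorem condMutualInfo_chain [Fintype α] [Fintype β] [Fintype γ] [Fintype δ] {p : Ω → ℝ}
    (hp : ∀ ω, 0 ≤ p ω) (A : Ω → α) (B : Ω → β) (C : Ω → γ) (D : Ω → δ) :
    condMutualInfo p A B (fun ω => (C ω, D ω)) + condMutualInfo p A D C =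
      condMutualInfo p A (fun ω => (D ω, B ω)) C := by
  simp_rw [condMutualInfo_eq_sum]
  rw [← Finset.sum_add_distrib]
  refine Finset.sum_congr rfl fun ω _ => ?_
  rcases (hp ω).eq_or_lt with h | h
  · simp [← h]
  rw [← mul_add, ← Real.logb_mul (infoRatio_pos hp A B (fun ω => (C ω, D ω)) h).ne'
    (infoRatio_pos hp A D C h).ne']
  congr 2
  have e1 : law p (fun ω => (A ω, B ω, C ω, D ω)) (A ω, B ω, C ω, D ω) =
      law p (fun ω => (A ω, (D ω, B ω), C ω)) (A ω, (D ω, B ω), C ω) := 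
    law_congr p fun _ => by simp only [Prod.mk.injEq]; tauto
  have e2 : law p (fun ω => (C ω, D ω)) (C ω, D ω) = law p (fun ω => (D ω, C ω)) (D ω, C ω) := 
    law_congr p fun _ => by simp only [Prod.mk.injEq]; tauto
  have e3 : law p (fun ω => (A ω, C ω, D ω)) (A ω, C ω, D ω) =
      law p (fun ω => (A ω, D ω, C ω)) (A ω, D ω, C ω) := 
    law_congr p fun _ => by simp only [Prod.mk.injEq]; tauto
  have e4 : law p (fun ω => (B ω, C ω, D ω)) (B ω, C ω, D ω) =
      law p (fun ω => ((D ω, B ω), C ω)) ((D ω, B ω), C ω) := 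
    law_congr p fun _ => by simp only [Prod.mk.injEq]; tauto
  have h1 := law_pos hp (fun ω => (D ω, C ω)) h
  have h2 := law_pos hp (fun ω => (A ω, D ω, C ω)) h
  unfold infoRatio
  rw [e1, e2, e3, e4]
  field_simp

/-- Where the denominators are nonzero the summands are $p(a\mid b,c)$; otherwise they vanish, hence
only an inequality. This is the mean score condition on the codewords. -/
theorem sum_mul_infoRatio_le_one [Fintype α] {p : Ω → ℝ} (hp : ∀ ω, 0 ≤ p ω) (A : Ω → α)
    (B : Ω → β) (C : Ω → γ) (b : β) (c : γ) :
    ∑ a, law p (fun ω => (A ω, C ω)) (a, c) / law p C c * infoRatio p A B C a b c ≤ 1 := by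
  calc _ ≤ ∑ a, law p (fun ω => (A ω, B ω, C ω)) (a, b, c) /
        law p (fun ω => (B ω, C ω)) (b, c) := Finset.sum_le_sum fun a _ => ?_
    _ ≤ 1 := by
        rw [← Finset.sum_div, sum_law_fst p A (fun ω => (B ω, C ω))]
        exact div_self_le_one _
  have h1 := law_nonneg hp (fun ω => (A ω, B ω, C ω)) (a, b, c)
  have h2 := law_nonneg hp (fun ω => (B ω, C ω)) (b, c)
  rcases eq_or_ne (law p C c) 0 with h | h
  · simpa [h] using div_nonneg h1 h2
  rcases eq_or_ne (law p (fun ω => (A ω, C ω)) (a, c)) 0 with h' | h'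
  · simpa [h'] using div_nonneg h1 h2
  rcases eq_or_ne (law p (fun ω => (B ω, C ω)) (b, c)) 0 with h3 | h3
  · simp [infoRatio, h3]
  refine le_of_eq ?_
  unfold infoRatio
  field_simp

/-- From $\log y\ge1-1/y$: the inverse ratio has mean at most $\sum p(a,c)p(b,c)/p(c)$, which is the
total mass. It serves to make the binning rate nonnegative. -/
theorem condMutualInfo_nonneg [Fintype α] [Fintype β] [Fintype γ] {p : Ω → ℝ}
    (hp : ∀ ω, 0 ≤ p ω) (A : Ω → α) (B : Ω → β) (C : Ω → γ) : 0 ≤ condMutualInfo p A B C := by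
  have hlog : (0 : ℝ) < Real.log 2 := Real.log_pos one_lt_two
  rw [condMutualInfo_eq_sum]
  have key : ∀ ω, p ω * (1 - (infoRatio p A B C (A ω) (B ω) (C ω))⁻¹) / Real.log 2 ≤
      p ω * Real.logb 2 (infoRatio p A B C (A ω) (B ω) (C ω)) := by
    intro ω
    rcases (hp ω).eq_or_lt with h | h
    · simp [← h]
    rw [mul_div_assoc, Real.logb]
    exact mul_le_mul_of_nonneg_left (div_le_div_of_nonneg_right
      (Real.one_sub_inv_le_log_of_pos (infoRatio_pos hp A B C h)) hlog.le) h.le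
  refine le_trans ?_ (Finset.sum_le_sum fun ω _ => key ω)
  rw [← Finset.sum_div]
  refine div_nonneg ?_ hlog.le
  simp_rw [mul_sub, mul_one]
  rw [Finset.sum_sub_distrib, sub_nonneg,
    ← sum_law_mul p (fun ω => (A ω, B ω, C ω))
      fun abc => (infoRatio p A B C abc.1 abc.2.1 abc.2.2)⁻¹]
  calc _ ≤ ∑ abc : α × β × γ, law p (fun ω => (A ω, C ω)) (abc.1, abc.2.2) *
        law p (fun ω => (B ω, C ω)) (abc.2.1, abc.2.2) / law p C abc.2.2 := by
        refine Finset.sum_le_sum fun abc _ => ?_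
        have h1 := law_nonneg hp (fun ω => (A ω, C ω)) (abc.1, abc.2.2)
        have h2 := law_nonneg hp (fun ω => (B ω, C ω)) (abc.2.1, abc.2.2)
        have h3 := law_nonneg hp C abc.2.2
        rcases eq_or_ne (law p (fun ω => (A ω, B ω, C ω)) abc) 0 with h | h
        · rw [h, zero_mul]; positivity
        refine le_of_eq ?_
        unfold infoRatio
        rw [inv_div]
        field_simp
    _ = ∑ c, ∑ a, ∑ b, law p (fun ω => (A ω, C ω)) (a, c) *
        law p (fun ω => (B ω, C ω)) (b, c) / law p C c := by
        simp_rw [Fintype.sum_prod_type]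
        rw [Finset.sum_comm]
        simp_rw [Finset.sum_comm (s := (Finset.univ : Finset γ))]
        rw [Finset.sum_comm]
    _ = ∑ c, law p C c := by
        refine Finset.sum_congr rfl fun c _ => ?_
        simp_rw [← Finset.sum_div, ← Finset.mul_sum, ← Finset.sum_mul,
          sum_law_fst p A C, sum_law_fst p B C]
        exact mul_self_div_self _
    _ = ∑ ω, p ω := sum_law p C

end Info

/-! ### Exponential bounds -/

/-- Markov's inequality with a small exponent: a variable whose mean logarithm is negative has a
fractional moment below one. -/
theorem exists_sum_mul_rpow_lt_one {Ω : Type*} [Fintype Ω] (p x : Ω → ℝ) (hp1 : ∑ ω, p ω = 1)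
    (hx : ∀ ω, p ω ≠ 0 → 0 < x ω) (hneg : ∑ ω, p ω * Real.log (x ω) < 0) :
    ∃ t : ℝ, 0 < t ∧ t ≤ 1 ∧ ∑ ω, p ω * x ω ^ t < 1 := by
  -- The moment equals 1 at $t=0$ and its derivative there is the mean logarithm, so it drops below
  -- 1 just to the right.
  have hd : HasDerivAt (fun t : ℝ => ∑ ω, p ω * x ω ^ t) (∑ ω, p ω * Real.log (x ω)) 0 := by
    refine HasDerivAt.fun_sum fun ω _ => ?_
    rcases eq_or_ne (p ω) 0 with h | h
    · simpa [h] using hasDerivAt_const (0 : ℝ) (0 : ℝ)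
    · have := ((hasDerivAt_id (0 : ℝ)).const_rpow (hx ω h)).const_mul (p ω)
      simpa using this
  have hs := hasDerivAt_iff_tendsto_slope.1 hd
  have hs' := (hs.mono_left (nhdsWithin_mono (0 : ℝ)
    (fun y hy => (ne_of_gt hy : y ≠ 0) : Set.Ioi (0 : ℝ) ⊆ {0}ᶜ))).eventually
    (gt_mem_nhds hneg)
  have hle : ∀ᶠ t : ℝ in 𝓝[>] 0, t ≤ 1 :=
    (eventually_le_nhds zero_lt_one).filter_mono nhdsWithin_le_nhds
  obtain ⟨t, ⟨ht, ht1⟩, ht0⟩ := ((hs'.and hle).and self_mem_nhdsWithin).exists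
  have ht0 : 0 < t := ht0
  refine ⟨t, ht0, ht1, ?_⟩
  rw [slope_def_field, sub_zero, div_lt_iff₀ ht0, zero_mul, sub_neg] at ht
  simpa [hp1] using ht

theorem min_one_le_rpow {z t : ℝ} (hz : 0 ≤ z) (ht0 : 0 < t) (ht1 : t ≤ 1) : min 1 z ≤ z ^ t := by
  rcases le_total 1 z with h | h
  · exact (min_le_left _ _).trans (Real.one_le_rpow h ht0.le)
  · refine (min_le_right _ _).trans ?_
    rcases hz.eq_or_lt with h0 | h0
    · rw [← h0, Real.zero_rpow ht0.ne']
    · simpa using Real.rpow_le_rpow_of_exponent_ge h0 h ht1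

/-- The left side is at most $\min(1,z)$. Here `z` stands for an upper bound on $a/b$, stated so
that $b=0$ is allowed. -/
theorem div_add_le_rpow {a b z t : ℝ} (ha : 0 ≤ a) (hb : 0 ≤ b) (hz : a ≤ z * b) (hz0 : 0 ≤ z)
    (ht0 : 0 < t) (ht1 : t ≤ 1) : a / (a + b) ≤ z ^ t := by
  refine le_trans (le_min ?_ ?_) (min_one_le_rpow hz0 ht0 ht1)
  · exact div_le_one_of_le₀ (by linarith) (by linarith)
  · rcases (add_nonneg ha hb).eq_or_lt with h | h
    · simpa [← h] using hz0
    · rw [div_le_iff₀ h]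
      nlinarith

/-! ### Block codes -/

section Block

variable {𝒬₀ 𝒬₁ 𝒬₂ 𝒮 𝒳 𝒰 : Type*} [Fintype 𝒬₀] [Fintype 𝒬₁] [Fintype 𝒬₂] [Fintype 𝒳]

theorem SemanticChannel.errorProb_nonneg (ch : SemanticChannel 𝒬₀ 𝒬₁ 𝒬₂ 𝒮 𝒳) {M n : ℕ}
    (c : Code 𝒬₀ 𝒬₁ 𝒬₂ 𝒮 𝒳 M n) : 0 ≤ ch.errorProb c := by
  refine mul_nonneg (by positivity) (Finset.sum_nonneg fun w _ => Finset.sum_nonneg fun q₀ _ =>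
    Finset.sum_nonneg fun q₁ _ => Finset.sum_nonneg fun q₂ _ => Finset.sum_nonneg fun x _ =>
      mul_nonneg (mul_nonneg (Finset.prod_nonneg fun i _ => ch.ctx_mem.1 _)
        (Finset.prod_nonneg fun i _ => (ch.chan_mem _ _ _).1 _)) ?_)
  split_ifs <;> simp

theorem SemanticChannel.sum_block_eq_one (ch : SemanticChannel 𝒬₀ 𝒬₁ 𝒬₂ 𝒮 𝒳) {n : ℕ}
    (enc : (Fin n → 𝒬₀) → (Fin n → 𝒬₁) → (Fin n → 𝒮)) :
    ∑ q₀ : Fin n → 𝒬₀, ∑ q₁ : Fin n → 𝒬₁, ∑ q₂ : Fin n → 𝒬₂, ∑ x : Fin n → 𝒳,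
      (∏ i, ch.ctx (q₀ i, q₁ i, q₂ i)) *
        (∏ i, ch.chan (enc q₀ q₁ i) (q₀ i) (q₁ i) (x i)) = 1 := by
  have hx : ∀ q₀ q₁, ∑ x : Fin n → 𝒳, ∏ i, ch.chan (enc q₀ q₁ i) (q₀ i) (q₁ i) (x i) = 1 := by
    intro q₀ q₁
    rw [sum_pi_prod fun i x => ch.chan (enc q₀ q₁ i) (q₀ i) (q₁ i) x]
    exact Finset.prod_eq_one fun i _ => (ch.chan_mem _ _ _).2
  have h2 : ∀ (q₀ : Fin n → 𝒬₀) (q₁ : Fin n → 𝒬₁),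
      ∑ q₂ : Fin n → 𝒬₂, ∏ i, ch.ctx (q₀ i, q₁ i, q₂ i) = ∏ i, ∑ b, ch.ctx (q₀ i, q₁ i, b) :=
    fun q₀ q₁ => sum_pi_prod fun i b => ch.ctx (q₀ i, q₁ i, b)
  have h1 : ∀ q₀ : Fin n → 𝒬₀, ∑ q₁ : Fin n → 𝒬₁, ∏ i, ∑ b, ch.ctx (q₀ i, q₁ i, b) =
      ∏ i, ∑ a, ∑ b, ch.ctx (q₀ i, a, b) :=
    fun q₀ => sum_pi_prod fun i a => ∑ b, ch.ctx (q₀ i, a, b)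
  have h0 : ∑ q₀ : Fin n → 𝒬₀, ∏ i, ∑ a, ∑ b, ch.ctx (q₀ i, a, b) =
      ∏ _i : Fin n, ∑ q, ∑ a, ∑ b, ch.ctx (q, a, b) :=
    sum_pi_prod fun _ q => ∑ a, ∑ b, ch.ctx (q, a, b)
  simp_rw [← Finset.mul_sum, hx, mul_one, h2, h1, h0]
  refine Finset.prod_eq_one fun i _ => ?_
  simpa [Fintype.sum_prod_type] using ch.ctx_mem.2

/-- The probability of error is one minus the probability of correct decoding. -/
theorem SemanticChannel.errorProb_eq (ch : SemanticChannel 𝒬₀ 𝒬₁ 𝒬₂ 𝒮 𝒳) {M n : ℕ} [NeZero M]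
    (c : Code 𝒬₀ 𝒬₁ 𝒬₂ 𝒮 𝒳 M n) :
    ch.errorProb c = 1 - (1 / (M : ℝ)) * ∑ q₀ : Fin n → 𝒬₀, ∑ w : Fin M,
      ∑ q₁ : Fin n → 𝒬₁, ∑ y : (Fin n → 𝒬₂) × (Fin n → 𝒳),
        ((∏ i, ch.ctx (q₀ i, q₁ i, y.1 i)) *
          (∏ i, ch.chan (c.enc w q₀ q₁ i) (q₀ i) (q₁ i) (y.2 i))) *
            (if c.dec y.2 q₀ y.1 = w then 1 else 0) := by
  have hM : (M : ℝ) ≠ 0 := by exact_mod_cast NeZero.ne M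
  rw [Finset.sum_comm, SemanticChannel.errorProb]
  have h : (1 : ℝ) = 1 / (M : ℝ) * ∑ _w : Fin M, 1 := by simp [hM]
  nth_rw 3 [h]
  rw [← mul_sub, ← Finset.sum_sub_distrib]
  congr 1
  refine Finset.sum_congr rfl fun w _ => ?_
  rw [eq_sub_iff_add_eq]
  refine Eq.trans ?_ (ch.sum_block_eq_one (c.enc w))
  rw [← Finset.sum_add_distrib]
  refine Finset.sum_congr rfl fun q₀ _ => ?_
  rw [← Finset.sum_add_distrib]
  refine Finset.sum_congr rfl fun q₁ _ => ?_
  rw [Fintype.sum_prod_type, ← Finset.sum_add_distrib]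
  refine Finset.sum_congr rfl fun q₂ _ => ?_
  rw [← Finset.sum_add_distrib]
  refine Finset.sum_congr rfl fun x _ => ?_
  split_ifs <;> simp

variable [Fintype 𝒮] [Fintype 𝒰]

/-- The sum of a product weight over blocks of letters. -/
theorem sum_block_prod {n : ℕ} (φ : Letter 𝒬₀ 𝒬₁ 𝒬₂ 𝒰 𝒮 𝒳 → ℝ) :
    ∑ q₀ : Fin n → 𝒬₀, ∑ q₁ : Fin n → 𝒬₁, ∑ u : Fin n → 𝒰, ∑ s : Fin n → 𝒮,
      ∑ y : (Fin n → 𝒬₂) × (Fin n → 𝒳), ∏ i, φ (q₀ i, q₁ i, y.1 i, u i, s i, y.2 i) =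
        (∑ ω, φ ω) ^ n := by
  have h6 : ∀ (q₀ : Fin n → 𝒬₀) (q₁ : Fin n → 𝒬₁) (u : Fin n → 𝒰) (s : Fin n → 𝒮)
      (q₂ : Fin n → 𝒬₂), ∑ x : Fin n → 𝒳, ∏ i, φ (q₀ i, q₁ i, q₂ i, u i, s i, x i) =
        ∏ i, ∑ x, φ (q₀ i, q₁ i, q₂ i, u i, s i, x) := fun q₀ q₁ u s q₂ =>
    sum_pi_prod fun i x => φ (q₀ i, q₁ i, q₂ i, u i, s i, x)
  have h5 : ∀ (q₀ : Fin n → 𝒬₀) (q₁ : Fin n → 𝒬₁) (u : Fin n → 𝒰) (s : Fin n → 𝒮),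
      ∑ q₂ : Fin n → 𝒬₂, ∏ i, ∑ x, φ (q₀ i, q₁ i, q₂ i, u i, s i, x) =
        ∏ i, ∑ b, ∑ x, φ (q₀ i, q₁ i, b, u i, s i, x) := fun q₀ q₁ u s =>
    sum_pi_prod fun i b => ∑ x, φ (q₀ i, q₁ i, b, u i, s i, x)
  have h4 : ∀ (q₀ : Fin n → 𝒬₀) (q₁ : Fin n → 𝒬₁) (u : Fin n → 𝒰),
      ∑ s : Fin n → 𝒮, ∏ i, ∑ b, ∑ x, φ (q₀ i, q₁ i, b, u i, s i, x) =
        ∏ i, ∑ s, ∑ b, ∑ x, φ (q₀ i, q₁ i, b, u i, s, x) := fun q₀ q₁ u =>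
    sum_pi_prod fun i s => ∑ b, ∑ x, φ (q₀ i, q₁ i, b, u i, s, x)
  have h3 : ∀ (q₀ : Fin n → 𝒬₀) (q₁ : Fin n → 𝒬₁),
      ∑ u : Fin n → 𝒰, ∏ i, ∑ s, ∑ b, ∑ x, φ (q₀ i, q₁ i, b, u i, s, x) =
        ∏ i, ∑ u, ∑ s, ∑ b, ∑ x, φ (q₀ i, q₁ i, b, u, s, x) := fun q₀ q₁ =>
    sum_pi_prod fun i u => ∑ s, ∑ b, ∑ x, φ (q₀ i, q₁ i, b, u, s, x)
  have h2 : ∀ q₀ : Fin n → 𝒬₀,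
      ∑ q₁ : Fin n → 𝒬₁, ∏ i, ∑ u, ∑ s, ∑ b, ∑ x, φ (q₀ i, q₁ i, b, u, s, x) =
        ∏ i, ∑ a, ∑ u, ∑ s, ∑ b, ∑ x, φ (q₀ i, a, b, u, s, x) := fun q₀ =>
    sum_pi_prod fun i a => ∑ u, ∑ s, ∑ b, ∑ x, φ (q₀ i, a, b, u, s, x)
  have h1 : ∑ q₀ : Fin n → 𝒬₀, ∏ i, ∑ a, ∑ u, ∑ s, ∑ b, ∑ x, φ (q₀ i, a, b, u, s, x) =
      ∏ _i : Fin n, ∑ q, ∑ a, ∑ u, ∑ s, ∑ b, ∑ x, φ (q, a, b, u, s, x) :=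
    sum_pi_prod fun _ q => ∑ a, ∑ u, ∑ s, ∑ b, ∑ x, φ (q, a, b, u, s, x)
  simp_rw [Fintype.sum_prod_type, h6, h5, h4, h3, h2, h1]
  rw [Finset.prod_const, Finset.card_univ, Fintype.card_fin]
  congr 1
  refine Finset.sum_congr rfl fun q _ => Finset.sum_congr rfl fun a _ => ?_
  simp_rw [Finset.sum_comm (s := (Finset.univ : Finset 𝒬₂))]

theorem SemanticChannel.joint_nonneg (ch : SemanticChannel 𝒬₀ 𝒬₁ 𝒬₂ 𝒮 𝒳)
    {V : 𝒬₀ → 𝒬₁ → 𝒰 × 𝒮 → ℝ} (hV : ∀ q₀ q₁, V q₀ q₁ ∈ stdSimplex ℝ (𝒰 × 𝒮))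
    (ω : Letter 𝒬₀ 𝒬₁ 𝒬₂ 𝒰 𝒮 𝒳) : 0 ≤ ch.joint V ω :=
  mul_nonneg (mul_nonneg (ch.ctx_mem.1 _) ((hV _ _).1 _)) ((ch.chan_mem _ _ _).1 _)

theorem SemanticChannel.sum_joint (ch : SemanticChannel 𝒬₀ 𝒬₁ 𝒬₂ 𝒮 𝒳)
    {V : 𝒬₀ → 𝒬₁ → 𝒰 × 𝒮 → ℝ} (hV : ∀ q₀ q₁, V q₀ q₁ ∈ stdSimplex ℝ (𝒰 × 𝒮)) :
    ∑ ω, ch.joint V ω = 1 := by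
  have h1 : ∀ q₀ q₁, ∑ u, ∑ s, V q₀ q₁ (u, s) = 1 := fun q₀ q₁ => by
    rw [← Fintype.sum_prod_type]; exact (hV q₀ q₁).2
  have h2 := ch.ctx_mem.2
  simp_rw [Fintype.sum_prod_type] at h2 ⊢
  simp_rw [SemanticChannel.joint, ← Finset.mul_sum, (ch.chan_mem _ _ _).2, mul_one,
    ← Finset.mul_sum, h1, mul_one, h2]

theorem SemanticChannel.law_aux_sender_shared (ch : SemanticChannel 𝒬₀ 𝒬₁ 𝒬₂ 𝒮 𝒳)
    (V : 𝒬₀ → 𝒬₁ → 𝒰 × 𝒮 → ℝ) (q₀ : 𝒬₀) (q₁ : 𝒬₁) (u : 𝒰) :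
    law (ch.joint V) (fun ω => (auxVar ω, ctxSender ω, ctxShared ω)) (u, q₁, q₀) =
      (∑ b, ch.ctx (q₀, q₁, b)) * ∑ s, V q₀ q₁ (u, s) := by
  classical
  rw [law_eq_sum_ite (ch.joint V) (fun ω : Letter 𝒬₀ 𝒬₁ 𝒬₂ 𝒰 𝒮 𝒳 =>
    ω.1 = q₀ ∧ ω.2.1 = q₁ ∧ ω.2.2.2.1 = u)
    fun ω => by simp only [auxVar, ctxSender, ctxShared, Prod.mk.injEq]; tauto]
  simp_rw [Fintype.sum_prod_type]
  rw [Finset.sum_eq_single q₀ (fun q _ h => by simp [h]) (by simp),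
    Finset.sum_eq_single q₁ (fun q _ h => by simp [h]) (by simp), Finset.sum_mul]
  refine Finset.sum_congr rfl fun b _ => ?_
  rw [Finset.sum_eq_single u (fun u' _ h => by simp [h]) (by simp)]
  simp [SemanticChannel.joint, ← Finset.mul_sum, (ch.chan_mem _ _ _).2]

theorem SemanticChannel.law_sender_shared (ch : SemanticChannel 𝒬₀ 𝒬₁ 𝒬₂ 𝒮 𝒳)
    {V : 𝒬₀ → 𝒬₁ → 𝒰 × 𝒮 → ℝ} (hV : ∀ q₀ q₁, V q₀ q₁ ∈ stdSimplex ℝ (𝒰 × 𝒮))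
    (q₀ : 𝒬₀) (q₁ : 𝒬₁) :
    law (ch.joint V) (fun ω => (ctxSender ω, ctxShared ω)) (q₁, q₀) =
      ∑ b, ch.ctx (q₀, q₁, b) := by
  rw [← sum_law_fst (ch.joint V) auxVar fun ω => (ctxSender ω, ctxShared ω)]
  simp_rw [ch.law_aux_sender_shared]
  rw [← Finset.mul_sum, ← Fintype.sum_prod_type, (hV q₀ q₁).2, mul_one]

theorem SemanticChannel.law_sender_shared_le (ch : SemanticChannel 𝒬₀ 𝒬₁ 𝒬₂ 𝒮 𝒳)
    {V : 𝒬₀ → 𝒬₁ → 𝒰 × 𝒮 → ℝ} (hV : ∀ q₀ q₁, V q₀ q₁ ∈ stdSimplex ℝ (𝒰 × 𝒮))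
    (q₀ : 𝒬₀) (q₁ : 𝒬₁) :
    law (ch.joint V) (fun ω => (ctxSender ω, ctxShared ω)) (q₁, q₀) ≤
      law (ch.joint V) ctxShared q₀ := by
  rw [← sum_law_fst (ch.joint V) ctxSender ctxShared]
  exact Finset.single_le_sum (f := fun a =>
    law (ch.joint V) (fun ω => (ctxSender ω, ctxShared ω)) (a, q₀))
    (fun a _ => law_nonneg (ch.joint_nonneg hV) _ _) (Finset.mem_univ q₁)

theorem SemanticChannel.law_shared_pos (ch : SemanticChannel 𝒬₀ 𝒬₁ 𝒬₂ 𝒮 𝒳)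
    {V : 𝒬₀ → 𝒬₁ → 𝒰 × 𝒮 → ℝ} (hV : ∀ q₀ q₁, V q₀ q₁ ∈ stdSimplex ℝ (𝒰 × 𝒮))
    {q₀ : 𝒬₀} {q₁ : 𝒬₁} {q₂ : 𝒬₂} (h : ch.ctx (q₀, q₁, q₂) ≠ 0) :
    0 < law (ch.joint V) (fun ω => (ctxSender ω, ctxShared ω)) (q₁, q₀) ∧
      0 < law (ch.joint V) ctxShared q₀ := by
  have h1 : 0 < law (ch.joint V) (fun ω => (ctxSender ω, ctxShared ω)) (q₁, q₀) := by
    rw [ch.law_sender_shared hV]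
    exact ((ch.ctx_mem.1 _).lt_of_ne' h).trans_le (Finset.single_le_sum
      (f := fun b => ch.ctx (q₀, q₁, b)) (fun b _ => ch.ctx_mem.1 _) (Finset.mem_univ q₂))
  exact ⟨h1, h1.trans_le (ch.law_sender_shared_le hV q₀ q₁)⟩

/-- The joint law, factored through the law of the codeword letter `U` given `Q₀`. -/
theorem SemanticChannel.joint_eq_mul_infoRatio (ch : SemanticChannel 𝒬₀ 𝒬₁ 𝒬₂ 𝒮 𝒳)
    {V : 𝒬₀ → 𝒬₁ → 𝒰 × 𝒮 → ℝ} (hV : ∀ q₀ q₁, V q₀ q₁ ∈ stdSimplex ℝ (𝒰 × 𝒮))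
    (q₀ : 𝒬₀) (q₁ : 𝒬₁) (q₂ : 𝒬₂) (u : 𝒰) (s : 𝒮) (x : 𝒳) :
    law (ch.joint V) (fun ω => (auxVar ω, ctxShared ω)) (u, q₀) / law (ch.joint V) ctxShared q₀ *
      infoRatio (ch.joint V) auxVar ctxSender ctxShared u q₁ q₀ *
      (V q₀ q₁ (u, s) / ∑ s', V q₀ q₁ (u, s')) * (ch.ctx (q₀, q₁, q₂) * ch.chan s q₀ q₁ x) =
    ch.joint V (q₀, q₁, q₂, u, s, x) := by
  rw [SemanticChannel.joint]
  rcases eq_or_ne (ch.ctx (q₀, q₁, q₂)) 0 with hc | hc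
  · simp [hc]
  rcases eq_or_ne (V q₀ q₁ (u, s)) 0 with hv | hv
  · simp [hv]
  obtain ⟨h1, h0⟩ := ch.law_shared_pos hV hc
  have hs : 0 < ∑ s', V q₀ q₁ (u, s') := (((hV q₀ q₁).1 _).lt_of_ne' hv).trans_le
    (Finset.single_le_sum (f := fun s' => V q₀ q₁ (u, s')) (fun s' _ => (hV q₀ q₁).1 _)
      (Finset.mem_univ s))
  have h3 : law (ch.joint V) (fun ω => (auxVar ω, ctxSender ω, ctxShared ω)) (u, q₁, q₀) =
      law (ch.joint V) (fun ω => (ctxSender ω, ctxShared ω)) (q₁, q₀) * ∑ s', V q₀ q₁ (u, s') := by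
    rw [ch.law_aux_sender_shared, ch.law_sender_shared hV]
  have h4 : 0 < law (ch.joint V) (fun ω => (auxVar ω, ctxShared ω)) (u, q₀) := by
    refine (h3 ▸ mul_pos h1 hs).trans_le ?_
    rw [← sum_law_mid (ch.joint V) auxVar ctxSender ctxShared]
    exact Finset.single_le_sum (f := fun b =>
      law (ch.joint V) (fun ω => (auxVar ω, ctxSender ω, ctxShared ω)) (u, b, q₀))
      (fun a _ => law_nonneg (ch.joint_nonneg hV) _ _) (Finset.mem_univ q₁)
  rw [infoRatio, h3]
  field_simp

/-- The ratio `p(u | q₀, q̃₁) / p(u | q₀)` of a letter. -/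
noncomputable def SemanticChannel.senderRatio (ch : SemanticChannel 𝒬₀ 𝒬₁ 𝒬₂ 𝒮 𝒳)
    (V : 𝒬₀ → 𝒬₁ → 𝒰 × 𝒮 → ℝ) (ω : Letter 𝒬₀ 𝒬₁ 𝒬₂ 𝒰 𝒮 𝒳) : ℝ :=
  infoRatio (ch.joint V) auxVar ctxSender ctxShared (auxVar ω) (ctxSender ω) (ctxShared ω)

/-- The ratio `p(u | q₀, q̃₂, x) / p(u | q₀)` of a letter. -/
noncomputable def SemanticChannel.receiverRatio (ch : SemanticChannel 𝒬₀ 𝒬₁ 𝒬₂ 𝒮 𝒳)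
    (V : 𝒬₀ → 𝒬₁ → 𝒰 × 𝒮 → ℝ) (ω : Letter 𝒬₀ 𝒬₁ 𝒬₂ 𝒰 𝒮 𝒳) : ℝ :=
  infoRatio (ch.joint V) auxVar (fun ω => (ctxReceiver ω, message ω)) ctxShared
    (auxVar ω) (ctxReceiver ω, message ω) (ctxShared ω)

/-- The one-shot bound for blocks with a fixed shared context. -/
theorem SemanticChannel.exists_code_given_shared (ch : SemanticChannel 𝒬₀ 𝒬₁ 𝒬₂ 𝒮 𝒳)
    {V : 𝒬₀ → 𝒬₁ → 𝒰 × 𝒮 → ℝ} (hV : ∀ q₀ q₁, V q₀ q₁ ∈ stdSimplex ℝ (𝒰 × 𝒮))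
    [Nonempty 𝒮] (M L n : ℕ) [NeZero M] (q₀ : Fin n → 𝒬₀) :
    ∃ (enc : Fin M → (Fin n → 𝒬₁) → (Fin n → 𝒮))
      (dec : (Fin n → 𝒬₂) × (Fin n → 𝒳) → Fin M),
      M * ∑ q₁ : Fin n → 𝒬₁, ∑ u : Fin n → 𝒰, ∑ s : Fin n → 𝒮,
        ∑ y : (Fin n → 𝒬₂) × (Fin n → 𝒳),
          (∏ i, ch.joint V (q₀ i, q₁ i, y.1 i, u i, s i, y.2 i)) *
          (L / ((∏ i, ch.senderRatio V (q₀ i, q₁ i, y.1 i, u i, s i, y.2 i)) + L) *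
            ((∏ i, ch.receiverRatio V (q₀ i, q₁ i, y.1 i, u i, s i, y.2 i)) /
              ((∏ i, ch.receiverRatio V (q₀ i, q₁ i, y.1 i, u i, s i, y.2 i)) + M * L))) ≤
        ∑ w, ∑ q₁ : Fin n → 𝒬₁, ∑ y : (Fin n → 𝒬₂) × (Fin n → 𝒳),
          ((∏ i, ch.ctx (q₀ i, q₁ i, y.1 i)) *
            (∏ i, ch.chan (enc w q₁ i) (q₀ i) (q₁ i) (y.2 i))) *
              (if dec y = w then 1 else 0) := by
  have hp := ch.joint_nonneg hV
  have hW : ∀ (q₁ : Fin n → 𝒬₁) (s : Fin n → 𝒮) (y : (Fin n → 𝒬₂) × (Fin n → 𝒳)),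
      0 ≤ (∏ i, ch.ctx (q₀ i, q₁ i, y.1 i)) * ∏ i, ch.chan (s i) (q₀ i) (q₁ i) (y.2 i) :=
    fun q₁ s y => mul_nonneg (Finset.prod_nonneg fun i _ => ch.ctx_mem.1 _)
      (Finset.prod_nonneg fun i _ => (ch.chan_mem _ _ _).1 _)
  -- If some shared letter has probability zero, $p(u\mid q_0)$ is undefined, but the whole block
  -- has weight zero and any code will do.
  by_cases hq : ∀ i, law (ch.joint V) ctxShared (q₀ i) ≠ 0
  · obtain ⟨enc, dec, h⟩ := exists_code_oneShot (M := M) (L := L)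
      (fun (q₁ : Fin n → 𝒬₁) (s : Fin n → 𝒮) (y : (Fin n → 𝒬₂) × (Fin n → 𝒳)) =>
        (∏ i, ch.ctx (q₀ i, q₁ i, y.1 i)) * ∏ i, ch.chan (s i) (q₀ i) (q₁ i) (y.2 i)) hW
      (fun u : Fin n → 𝒰 => ∏ i, law (ch.joint V) (fun ω => (auxVar ω, ctxShared ω)) (u i, q₀ i) /
        law (ch.joint V) ctxShared (q₀ i))
      (fun u => Finset.prod_nonneg fun i _ => div_nonneg (law_nonneg hp _ _) (law_nonneg hp _ _))
      (by
        rw [sum_pi_prod fun i u => law (ch.joint V) (fun ω => (auxVar ω, ctxShared ω)) (u, q₀ i) /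
          law (ch.joint V) ctxShared (q₀ i)]
        refine Finset.prod_eq_one fun i _ => ?_
        rw [← Finset.sum_div, sum_law_fst, div_self (hq i)])
      (fun q₁ u => ∏ i, infoRatio (ch.joint V) auxVar ctxSender ctxShared (u i) (q₁ i) (q₀ i))
      (fun q₁ u => Finset.prod_nonneg fun i _ => infoRatio_nonneg hp _ _ _ _ _ _)
      (fun q₁ => by
        simp_rw [← Finset.prod_mul_distrib]
        rw [sum_pi_prod fun i u =>
          law (ch.joint V) (fun ω => (auxVar ω, ctxShared ω)) (u, q₀ i) /
            law (ch.joint V) ctxShared (q₀ i) *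
            infoRatio (ch.joint V) auxVar ctxSender ctxShared u (q₁ i) (q₀ i)]
        exact Finset.prod_le_one (fun i _ => Finset.sum_nonneg fun u _ =>
          mul_nonneg (div_nonneg (law_nonneg hp _ _) (law_nonneg hp _ _))
            (infoRatio_nonneg hp _ _ _ _ _ _))
          fun i _ => sum_mul_infoRatio_le_one hp _ _ _ _ _)
      (fun y u => ∏ i, infoRatio (ch.joint V) auxVar (fun ω => (ctxReceiver ω, message ω))
        ctxShared (u i) (y.1 i, y.2 i) (q₀ i))
      (fun y u => Finset.prod_nonneg fun i _ => infoRatio_nonneg hp _ _ _ _ _ _)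
      (fun y => by
        simp_rw [← Finset.prod_mul_distrib]
        rw [sum_pi_prod fun i u =>
          law (ch.joint V) (fun ω => (auxVar ω, ctxShared ω)) (u, q₀ i) /
            law (ch.joint V) ctxShared (q₀ i) *
            infoRatio (ch.joint V) auxVar (fun ω => (ctxReceiver ω, message ω))
              ctxShared u (y.1 i, y.2 i) (q₀ i)]
        exact Finset.prod_le_one (fun i _ => Finset.sum_nonneg fun u _ =>
          mul_nonneg (div_nonneg (law_nonneg hp _ _) (law_nonneg hp _ _))
            (infoRatio_nonneg hp _ _ _ _ _ _))
          fun i _ => sum_mul_infoRatio_le_one hp _ _ _ _ _)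
      (fun q₁ u s => ∏ i, V (q₀ i) (q₁ i) (u i, s i) / ∑ s', V (q₀ i) (q₁ i) (u i, s'))
      (fun q₁ u s => Finset.prod_nonneg fun i _ => div_nonneg ((hV _ _).1 _)
        (Finset.sum_nonneg fun _ _ => (hV _ _).1 _))
      (fun q₁ u => by
        rw [sum_pi_prod fun i s =>
          V (q₀ i) (q₁ i) (u i, s) / ∑ s', V (q₀ i) (q₁ i) (u i, s')]
        exact Finset.prod_le_one (fun i _ => Finset.sum_nonneg fun s _ =>
          div_nonneg ((hV _ _).1 _) (Finset.sum_nonneg fun _ _ => (hV _ _).1 _))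
          fun i _ => sum_div_sum_le_one _)
    refine ⟨enc, dec, le_trans (le_of_eq ?_) h⟩
    congr 1
    refine Finset.sum_congr rfl fun q₁ _ => Finset.sum_congr rfl fun u _ =>
      Finset.sum_congr rfl fun s _ => Finset.sum_congr rfl fun y _ => ?_
    simp_rw [← ch.joint_eq_mul_infoRatio hV, Finset.prod_mul_distrib]
    rfl
  · push Not at hq
    obtain ⟨i, hi⟩ := hq
    refine ⟨fun _ _ _ => Classical.arbitrary 𝒮, fun _ => 0, le_trans (le_of_eq ?_)
      (Finset.sum_nonneg fun w _ => Finset.sum_nonneg fun q₁ _ => Finset.sum_nonneg fun y _ =>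
        mul_nonneg (hW q₁ (fun _ => Classical.arbitrary 𝒮) y) (by split_ifs <;> simp))⟩
    refine mul_eq_zero_of_right _ (Finset.sum_eq_zero fun q₁ _ => Finset.sum_eq_zero fun u _ =>
      Finset.sum_eq_zero fun s _ => Finset.sum_eq_zero fun y _ => mul_eq_zero_of_left
        (Finset.prod_eq_zero (Finset.mem_univ i) ?_) _)
    have hc : ch.ctx (q₀ i, q₁ i, y.1 i) = 0 := by
      by_contra hc
      exact (ch.law_shared_pos hV hc).2.ne' hi
    simp [SemanticChannel.joint, hc]

/-- A union bound: $1-(1-a)(1-b)\le a+b$ for $a,b\ge0$. -/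
theorem one_sub_mul_le {F G L K : ℝ} (hF : 0 ≤ F) (hG : 0 ≤ G) (hL : 0 < L) (hK : 0 < K) :
    1 - L / (F + L) * (G / (G + K)) ≤ F / (F + L) + K / (K + G) := by
  have h1 : L / (F + L) = 1 - F / (F + L) := by field_simp; ring
  have h2 : G / (G + K) = 1 - K / (K + G) := by
    rw [add_comm K G]; field_simp; ring
  have h3 : 0 ≤ F / (F + L) := by positivity
  have h4 : 0 ≤ K / (K + G) := by positivity
  rw [h1, h2]
  nlinarith [mul_nonneg h3 h4]

/-- The one-shot bound for block codes. -/
theorem SemanticChannel.exists_code_errorProb_le (ch : SemanticChannel 𝒬₀ 𝒬₁ 𝒬₂ 𝒮 𝒳)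
    {V : 𝒬₀ → 𝒬₁ → 𝒰 × 𝒮 → ℝ} (hV : ∀ q₀ q₁, V q₀ q₁ ∈ stdSimplex ℝ (𝒰 × 𝒮))
    [Nonempty 𝒮] (M L n : ℕ) [NeZero M] [NeZero L] :
    ∃ c : Code 𝒬₀ 𝒬₁ 𝒬₂ 𝒮 𝒳 M n, ch.errorProb c ≤
      ∑ q₀ : Fin n → 𝒬₀, ∑ q₁ : Fin n → 𝒬₁, ∑ u : Fin n → 𝒰, ∑ s : Fin n → 𝒮,
        ∑ y : (Fin n → 𝒬₂) × (Fin n → 𝒳),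
          (∏ i, ch.joint V (q₀ i, q₁ i, y.1 i, u i, s i, y.2 i)) *
          ((∏ i, ch.senderRatio V (q₀ i, q₁ i, y.1 i, u i, s i, y.2 i)) /
            ((∏ i, ch.senderRatio V (q₀ i, q₁ i, y.1 i, u i, s i, y.2 i)) + L) +
           M * L /
            (M * L + ∏ i, ch.receiverRatio V (q₀ i, q₁ i, y.1 i, u i, s i, y.2 i))) := by
  have hM : (0 : ℝ) < M := by exact_mod_cast Nat.pos_of_ne_zero (NeZero.ne M)
  have hL : (0 : ℝ) < L := by exact_mod_cast Nat.pos_of_ne_zero (NeZero.ne L)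
  have hp := ch.joint_nonneg hV
  -- Both terminals know $q_0^n$, so each shared block may have a code of its own.
  choose enc dec h using fun q₀ : Fin n → 𝒬₀ => ch.exists_code_given_shared hV M L n q₀
  refine ⟨⟨fun w q₀ => enc q₀ w, fun x q₀ q₂ => dec q₀ (q₂, x)⟩, ?_⟩
  rw [ch.errorProb_eq]
  have hsum := mul_le_mul_of_nonneg_left
    (Finset.sum_le_sum (s := Finset.univ) fun q₀ _ => h q₀)
    (show 0 ≤ 1 / (M : ℝ) by positivity)
  rw [← Finset.mul_sum, ← mul_assoc, one_div_mul_cancel hM.ne', one_mul] at hsum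
  refine (sub_le_sub_left hsum 1).trans ?_
  have hone := sum_block_prod (n := n) (ch.joint V)
  rw [ch.sum_joint hV, one_pow] at hone
  rw [← hone]
  simp_rw [← Finset.sum_sub_distrib]
  refine Finset.sum_le_sum fun q₀ _ => Finset.sum_le_sum fun q₁ _ => Finset.sum_le_sum fun u _ =>
    Finset.sum_le_sum fun s _ => Finset.sum_le_sum fun y _ => ?_
  rw [← mul_one_sub]
  exact mul_le_mul_of_nonneg_left (one_sub_mul_le
    (Finset.prod_nonneg fun i _ => infoRatio_nonneg hp _ _ _ _ _ _)
    (Finset.prod_nonneg fun i _ => infoRatio_nonneg hp _ _ _ _ _ _) hL (by positivity))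
    (Finset.prod_nonneg fun i _ => hp _)

end Block

/-! ### Error exponents and achievable rates -/

section Achievability

variable {𝒬₀ 𝒬₁ 𝒬₂ 𝒮 𝒳 𝒰 : Type*} [Fintype 𝒬₀] [Fintype 𝒬₁] [Fintype 𝒬₂] [Fintype 𝒳]

/-- Rounding up at most doubles a number that is at least 1; this needs $a\ge0$, so negative rates
are treated separately. -/
theorem ceil_two_rpow_le {a : ℝ} (ha : 0 ≤ a) (n : ℕ) :
    (⌈(2 : ℝ) ^ ((n : ℝ) * a)⌉₊ : ℝ) ≤ 2 * ((2 : ℝ) ^ a) ^ n := by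
  have h : (2 : ℝ) ^ ((n : ℝ) * a) = ((2 : ℝ) ^ a) ^ n := by
    rw [mul_comm, Real.rpow_mul_natCast zero_le_two]
  have h1 : (1 : ℝ) ≤ ((2 : ℝ) ^ a) ^ n :=
    one_le_pow₀ (Real.one_le_rpow one_le_two ha)
  have h2 := Nat.ceil_lt_add_one (a := (2 : ℝ) ^ ((n : ℝ) * a)) (by positivity)
  rw [h] at h2 ⊢
  linarith

theorem le_ceil_two_rpow (a : ℝ) (n : ℕ) :
    ((2 : ℝ) ^ a) ^ n ≤ (⌈(2 : ℝ) ^ ((n : ℝ) * a)⌉₊ : ℝ) := by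
  rw [← Real.rpow_mul_natCast zero_le_two, mul_comm]
  exact Nat.le_ceil _

theorem ceil_two_rpow_ne_zero (a : ℝ) : ⌈(2 : ℝ) ^ a⌉₊ ≠ 0 :=
  (Nat.ceil_pos.2 (by positivity)).ne'

theorem SemanticChannel.achievable_of_neg (ch : SemanticChannel 𝒬₀ 𝒬₁ 𝒬₂ 𝒮 𝒳) [Nonempty 𝒮]
    {R : ℝ} (hR : R < 0) : ch.Achievable R := by
  have hle : ∀ n : ℕ, ⌈(2 : ℝ) ^ ((n : ℝ) * R)⌉₊ ≤ 1 := fun n => by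
    rw [Nat.ceil_le, Nat.cast_one]
    exact Real.rpow_le_one_of_one_le_of_nonpos one_le_two
      (mul_nonpos_of_nonneg_of_nonpos n.cast_nonneg hR.le)
  refine ⟨fun n => ⟨fun _ _ _ _ => Classical.arbitrary 𝒮,
    fun _ _ _ => ⟨0, Nat.pos_of_ne_zero (ceil_two_rpow_ne_zero _)⟩⟩, ?_⟩
  refine tendsto_const_nhds.congr fun n => Eq.symm ?_
  have : Subsingleton (Fin ⌈(2 : ℝ) ^ ((n : ℝ) * R)⌉₊) := Fin.subsingleton_iff_le_one.2 (hle n)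
  rw [SemanticChannel.errorProb]
  refine mul_eq_zero_of_right _ (Finset.sum_eq_zero fun w _ => Finset.sum_eq_zero fun q₀ _ =>
    Finset.sum_eq_zero fun q₁ _ => Finset.sum_eq_zero fun q₂ _ => Finset.sum_eq_zero fun x _ => ?_)
  rw [if_pos (Subsingleton.elim _ _), mul_zero]

variable [Fintype 𝒮] [Fintype 𝒰]

/-- Here `r` is the rate of the bins, $L=\lceil2^{nr}\rceil$. The two terms are the failures of the
encoder to find a fitting codeword and of the decoder to single it out; the 4 comes from rounding up
both $M$ and $L$. -/
theorem SemanticChannel.exists_code_errorProb_le_pow (ch : SemanticChannel 𝒬₀ 𝒬₁ 𝒬₂ 𝒮 𝒳)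
    {V : 𝒬₀ → 𝒬₁ → 𝒰 × 𝒮 → ℝ} (hV : ∀ q₀ q₁, V q₀ q₁ ∈ stdSimplex ℝ (𝒰 × 𝒮))
    [Nonempty 𝒮] {R r t₁ t₂ : ℝ} (hR : 0 ≤ R) (hr : 0 ≤ r) (ht₁ : 0 < t₁) (ht₁' : t₁ ≤ 1)
    (ht₂ : 0 < t₂) (ht₂' : t₂ ≤ 1) (n : ℕ) :
    ∃ c : Code 𝒬₀ 𝒬₁ 𝒬₂ 𝒮 𝒳 ⌈(2 : ℝ) ^ ((n : ℝ) * R)⌉₊ n, ch.errorProb c ≤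
      (∑ ω, ch.joint V ω * (ch.senderRatio V ω / 2 ^ r) ^ t₁) ^ n +
        4 * (∑ ω, ch.joint V ω * (2 ^ (R + r) / ch.receiverRatio V ω) ^ t₂) ^ n := by
  have hp := ch.joint_nonneg hV
  have hf : ∀ ω, 0 ≤ ch.senderRatio V ω := fun ω => infoRatio_nonneg hp _ _ _ _ _ _
  have hg : ∀ ω, 0 ≤ ch.receiverRatio V ω := fun ω => infoRatio_nonneg hp _ _ _ _ _ _
  have : NeZero ⌈(2 : ℝ) ^ ((n : ℝ) * R)⌉₊ := ⟨ceil_two_rpow_ne_zero _⟩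
  have : NeZero ⌈(2 : ℝ) ^ ((n : ℝ) * r)⌉₊ := ⟨ceil_two_rpow_ne_zero _⟩
  obtain ⟨c, hc⟩ := ch.exists_code_errorProb_le hV ⌈(2 : ℝ) ^ ((n : ℝ) * R)⌉₊
    ⌈(2 : ℝ) ^ ((n : ℝ) * r)⌉₊ n
  refine ⟨c, hc.trans ?_⟩
  have hL := le_ceil_two_rpow r n
  have hML : (⌈(2 : ℝ) ^ ((n : ℝ) * R)⌉₊ : ℝ) * ⌈(2 : ℝ) ^ ((n : ℝ) * r)⌉₊ ≤
      4 * ((2 : ℝ) ^ (R + r)) ^ n := by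
    refine (mul_le_mul (ceil_two_rpow_le hR n) (ceil_two_rpow_le hr n) (by positivity)
      (by positivity)).trans (le_of_eq ?_)
    rw [Real.rpow_add zero_lt_two, mul_pow]
    ring
  have hML0 : 0 ≤ (⌈(2 : ℝ) ^ ((n : ℝ) * R)⌉₊ : ℝ) * ⌈(2 : ℝ) ^ ((n : ℝ) * r)⌉₊ := by positivity
  have hL0 : (0 : ℝ) ≤ ⌈(2 : ℝ) ^ ((n : ℝ) * r)⌉₊ := by positivity
  generalize (⌈(2 : ℝ) ^ ((n : ℝ) * R)⌉₊ : ℝ) * ⌈(2 : ℝ) ^ ((n : ℝ) * r)⌉₊ = K at hML hML0 ⊢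
  generalize (⌈(2 : ℝ) ^ ((n : ℝ) * r)⌉₊ : ℝ) = L at hL hL0 ⊢
  have h4 : (4 : ℝ) ^ t₂ ≤ 4 := by
    simpa using Real.rpow_le_rpow_of_exponent_le (by norm_num : (1 : ℝ) ≤ 4) ht₂'
  have hblock : ∀ l : Fin n → Letter 𝒬₀ 𝒬₁ 𝒬₂ 𝒰 𝒮 𝒳,
      (∏ i, ch.joint V (l i)) * ((∏ i, ch.senderRatio V (l i)) /
        ((∏ i, ch.senderRatio V (l i)) + L) + K / (K + ∏ i, ch.receiverRatio V (l i))) ≤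
      (∏ i, ch.joint V (l i) * (ch.senderRatio V (l i) / 2 ^ r) ^ t₁) +
        4 * ∏ i, ch.joint V (l i) * (2 ^ (R + r) / ch.receiverRatio V (l i)) ^ t₂ := by
    intro l
    rw [Finset.prod_mul_distrib, Finset.prod_mul_distrib, mul_left_comm 4, ← mul_add]
    -- Positive mass of every letter makes the receiver's ratios positive, so they may be divided
    -- by.
    by_cases h0 : ∀ i, ch.joint V (l i) ≠ 0
    · have hgpos : ∀ i, 0 < ch.receiverRatio V (l i) := fun i =>
        infoRatio_pos hp auxVar (fun ω => (ctxReceiver ω, message ω)) ctxShared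
          ((hp (l i)).lt_of_ne' (h0 i))
      refine mul_le_mul_of_nonneg_left (add_le_add ?_ ?_) (Finset.prod_nonneg fun i _ => hp _)
      · rw [Real.finsetProd_rpow _ _ fun i _ => div_nonneg (hf _) (by positivity)]
        have hz : 0 ≤ ∏ i, ch.senderRatio V (l i) / 2 ^ r :=
          Finset.prod_nonneg fun i _ => div_nonneg (hf _) (by positivity)
        refine div_add_le_rpow (Finset.prod_nonneg fun i _ => hf _) hL0
          (le_trans (le_of_eq ?_) (mul_le_mul_of_nonneg_left hL hz)) hz ht₁ ht₁'
        rw [Finset.prod_div_distrib, Finset.prod_const, Finset.card_univ, Fintype.card_fin,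
          div_mul_cancel₀ _ (by positivity)]
      · have hz : 0 ≤ ∏ i, 2 ^ (R + r) / ch.receiverRatio V (l i) :=
          Finset.prod_nonneg fun i _ => div_nonneg (by positivity) (hg _)
        rw [Real.finsetProd_rpow _ _ fun i _ => div_nonneg (by positivity) (hg _)]
        refine (div_add_le_rpow (z := 4 * ∏ i, 2 ^ (R + r) / ch.receiverRatio V (l i)) hML0
          (Finset.prod_nonneg fun i _ => hg _) (hML.trans (le_of_eq ?_)) (by positivity)
          ht₂ ht₂').trans ?_
        · rw [Finset.prod_div_distrib, Finset.prod_const, Finset.card_univ, Fintype.card_fin,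
            mul_assoc, div_mul_cancel₀ _ (Finset.prod_pos fun i _ => hgpos i).ne']
        · rw [Real.mul_rpow (by norm_num) hz]
          exact mul_le_mul_of_nonneg_right h4 (Real.rpow_nonneg hz _)
    · push Not at h0
      obtain ⟨i, hi⟩ := h0
      have : ∏ i, ch.joint V (l i) = 0 := Finset.prod_eq_zero (Finset.mem_univ i) hi
      simp [this]
  rw [← sum_block_prod (n := n) fun ω => ch.joint V ω * (ch.senderRatio V ω / 2 ^ r) ^ t₁,
    ← sum_block_prod (n := n) fun ω => ch.joint V ω * (2 ^ (R + r) / ch.receiverRatio V ω) ^ t₂]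
  simp_rw [Finset.mul_sum, ← Finset.sum_add_distrib]
  exact Finset.sum_le_sum fun q₀ _ => Finset.sum_le_sum fun q₁ _ => Finset.sum_le_sum fun u _ =>
    Finset.sum_le_sum fun s _ => Finset.sum_le_sum fun y _ =>
      hblock fun i => (q₀ i, q₁ i, y.1 i, u i, s i, y.2 i)

/-- Every rate below `I(U; Q̃₂, X | Q₀) - I(U; Q̃₁ | Q₀)` is achievable. -/
theorem SemanticChannel.achievable_of_lt (ch : SemanticChannel 𝒬₀ 𝒬₁ 𝒬₂ 𝒮 𝒳)
    {V : 𝒬₀ → 𝒬₁ → 𝒰 × 𝒮 → ℝ} (hV : ∀ q₀ q₁, V q₀ q₁ ∈ stdSimplex ℝ (𝒰 × 𝒮))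
    [Nonempty 𝒮] {R : ℝ} (hR0 : 0 ≤ R)
    (hR : R < condMutualInfo (ch.joint V) auxVar (fun ω => (ctxReceiver ω, message ω)) ctxShared
      - condMutualInfo (ch.joint V) auxVar ctxSender ctxShared) : ch.Achievable R := by
  have hp := ch.joint_nonneg hV
  have hp1 := ch.sum_joint hV
  have hlog : (0 : ℝ) < Real.log 2 := Real.log_pos one_lt_two
  have hI := condMutualInfo_nonneg hp auxVar ctxSender ctxShared
  have hI1 : condMutualInfo (ch.joint V) auxVar ctxSender ctxShared =
      ∑ ω, ch.joint V ω * Real.logb 2 (ch.senderRatio V ω) := condMutualInfo_eq_sum _ _ _ _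
  have hI2 : condMutualInfo (ch.joint V) auxVar (fun ω => (ctxReceiver ω, message ω)) ctxShared =
      ∑ ω, ch.joint V ω * Real.logb 2 (ch.receiverRatio V ω) := condMutualInfo_eq_sum _ _ _ _
  generalize condMutualInfo (ch.joint V) auxVar ctxSender ctxShared = I₁ at hR hI hI1
  generalize condMutualInfo (ch.joint V) auxVar (fun ω => (ctxReceiver ω, message ω))
    ctxShared = I₂ at hR hI2
  have hf : ∀ ω, 0 ≤ ch.senderRatio V ω := fun ω => infoRatio_nonneg hp _ _ _ _ _ _
  have hg : ∀ ω, 0 ≤ ch.receiverRatio V ω := fun ω => infoRatio_nonneg hp _ _ _ _ _ _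
  have hfpos : ∀ ω, ch.joint V ω ≠ 0 → 0 < ch.senderRatio V ω := fun ω h =>
    infoRatio_pos hp auxVar ctxSender ctxShared ((hp ω).lt_of_ne' h)
  have hgpos : ∀ ω, ch.joint V ω ≠ 0 → 0 < ch.receiverRatio V ω := fun ω h =>
    infoRatio_pos hp auxVar (fun ω => (ctxReceiver ω, message ω)) ctxShared
      ((hp ω).lt_of_ne' h)
  -- The slack $I_2-I_1-R$ is split equally between encoder and decoder.
  obtain ⟨r, hr1, hr2⟩ : ∃ r, I₁ < r ∧ R + r < I₂ :=
    ⟨I₁ + (I₂ - I₁ - R) / 2, by linarith, by linarith⟩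
  obtain ⟨t₁, ht₁, ht₁', hlt₁⟩ := exists_sum_mul_rpow_lt_one (ch.joint V)
    (fun ω => ch.senderRatio V ω / 2 ^ r) hp1 (fun ω h => div_pos (hfpos ω h) (by positivity)) (by
      have : ∑ ω, ch.joint V ω * Real.log (ch.senderRatio V ω / 2 ^ r) =
          ∑ ω, (ch.joint V ω * Real.logb 2 (ch.senderRatio V ω) - ch.joint V ω * r) *
            Real.log 2 := by
        refine Finset.sum_congr rfl fun ω _ => ?_
        rcases eq_or_ne (ch.joint V ω) 0 with h | h
        · simp [h]
        rw [Real.log_div (hfpos ω h).ne' (by positivity), Real.log_rpow zero_lt_two, Real.logb]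
        field_simp
      rw [this, ← Finset.sum_mul, Finset.sum_sub_distrib, ← Finset.sum_mul, hp1, ← hI1, one_mul]
      exact mul_neg_of_neg_of_pos (by linarith) hlog)
  obtain ⟨t₂, ht₂, ht₂', hlt₂⟩ := exists_sum_mul_rpow_lt_one (ch.joint V)
    (fun ω => 2 ^ (R + r) / ch.receiverRatio V ω) hp1
    (fun ω h => div_pos (by positivity) (hgpos ω h)) (by
      have : ∑ ω, ch.joint V ω * Real.log (2 ^ (R + r) / ch.receiverRatio V ω) =
          ∑ ω, (ch.joint V ω * (R + r) - ch.joint V ω * Real.logb 2 (ch.receiverRatio V ω)) *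
            Real.log 2 := by
        refine Finset.sum_congr rfl fun ω _ => ?_
        rcases eq_or_ne (ch.joint V ω) 0 with h | h
        · simp [h]
        rw [Real.log_div (by positivity) (hgpos ω h).ne', Real.log_rpow zero_lt_two, Real.logb]
        field_simp
      rw [this, ← Finset.sum_mul, Finset.sum_sub_distrib, ← Finset.sum_mul, hp1, ← hI2, one_mul]
      exact mul_neg_of_neg_of_pos (by linarith) hlog)
  choose c hc using ch.exists_code_errorProb_le_pow hV hR0 (hI.trans hr1.le) ht₁ ht₁' ht₂ ht₂'
  refine ⟨c, squeeze_zero (fun n => ch.errorProb_nonneg (c n)) hc ?_⟩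
  have h1 := tendsto_pow_atTop_nhds_zero_of_lt_one (Finset.sum_nonneg fun ω _ => mul_nonneg (hp ω)
    (Real.rpow_nonneg (div_nonneg (hf ω) (by positivity)) _)) hlt₁
  have h2 := tendsto_pow_atTop_nhds_zero_of_lt_one (Finset.sum_nonneg fun ω _ => mul_nonneg (hp ω)
    (Real.rpow_nonneg (div_nonneg (by positivity) (hg ω)) _)) hlt₂
  simpa using h1.add (h2.const_mul 4)

end Achievability

end SemComm

theorem theorem5 {𝒬₀ 𝒬₁ 𝒬₂ 𝒮 𝒳 𝒰 : Type*}
    [Fintype 𝒬₀] [Fintype 𝒬₁] [Fintype 𝒬₂] [Fintype 𝒮] [Fintype 𝒳] [Fintype 𝒰]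
    (ch : SemComm.SemanticChannel 𝒬₀ 𝒬₁ 𝒬₂ 𝒮 𝒳)
    (V : 𝒬₀ → 𝒬₁ → 𝒰 × 𝒮 → ℝ) (hV : ∀ q₀ q₁, V q₀ q₁ ∈ stdSimplex ℝ (𝒰 × 𝒮))
    (R : ℝ)
    (hR : R < SemComm.condMutualInfo (ch.joint V)
                  SemComm.auxVar SemComm.message SemComm.ctxReceiverAll
            + SemComm.condMutualInfo (ch.joint V)
                  SemComm.auxVar SemComm.ctxReceiver SemComm.ctxShared
            - SemComm.condMutualInfo (ch.joint V)
                  SemComm.auxVar SemComm.ctxSender SemComm.ctxShared) :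
    ch.Achievable R := by
  -- Some context letter exists, and there `V` is a probability mass function on $\mathcal
  -- U\times\mathcal S$.
  have hne : Nonempty 𝒮 := by
    by_contra h𝒮
    rw [not_nonempty_iff] at h𝒮
    obtain ⟨q, -, -⟩ := Finset.exists_ne_zero_of_sum_ne_zero
      (ch.ctx_mem.2.trans_ne one_ne_zero)
    simpa using (hV q.1 q.2.1).2
  rcases lt_or_ge R 0 with hR0 | hR0
  · exact ch.achievable_of_neg hR0
  · refine ch.achievable_of_lt hV hR0 (hR.trans_eq ?_)
    rw [← SemComm.condMutualInfo_chain (ch.joint_nonneg hV)]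
    rfl
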